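/- Let $\mathfrak g$ be a finite-dimensional semisimple Lie algebra over $\mathbb C$, $\mathfrak h\subset\mathfrak b\subset\mathfrak g$ a Cartan subalgebra and a Borel subalgebra containing it, and $\Gamma\subset\mathfrak h^*$ the corresponding set of simple roots. Let $G$ be the adjoint group of $\mathfrak g$ (the group of inner automorphisms of $\mathfrak g$) and $B\subset G$ the Borel subgroup with Lie algebra $\mathfrak b$. Let $\mathfrak g=\bigoplus_k\mathfrak g_k$ be the Lie algebra grading with $\mathfrak g_0=\mathfrak h$, $\mathfrak g_{\pm1}=\bigoplus_{\alpha\in\Gamma}\mathfrak g^{\pm\alpha}$, and put $\mathfrak g^k=\bigoplus_{r\ge k}\mathfrak g_r$. Let $Y$ be a smooth algebraic curve over $\mathbb C$ with tangent sheaf $\Theta$. For a $B$-bundle $\mathcal F$ on $Y$ let $\mathcal E_{\mathcal F}$ be the algebroid of infinitesimal symmetries of $\mathcal F$, let $\mathcal E^{\mathfrak g}_{\mathcal F}$ be the algebroid of infinitesimal symmetries of the induced $G$-bundle $\mathcal F\times^B G$, and let $\mathcal E^{-1}_{\mathcal F}\subset\mathcal E^{\mathfrak g}_{\mathcal F}$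 be the preimage of $\mathfrak g^{-1}_{\mathcal F}/\mathfrak b_{\mathcal F}\subset\mathfrak g_{\mathcal F}/\mathfrak b_{\mathcal F}=\mathcal E^{\mathfrak g}_{\mathcal F}/\mathcal E_{\mathcal F}$, where the subscript $\mathcal F$ denotes the $\mathcal F$-twist of a $B$-module; thus $\mathcal E^{-1}_{\mathcal F}/\mathcal E_{\mathcal F}=\bigoplus_{\alpha\in\Gamma}\mathfrak g^{-\alpha}_{\mathcal F}$. A $\mathfrak g$-oper on $Y$ is a $B$-bundle $\mathcal F$ on $Y$ together with a connection $\nabla$ on $\mathcal F\times^B G$, i.e. an $\mathcal O_Y$-linear splitting $\nabla:\Theta\to\mathcal E^{\mathfrak g}_{\mathcal F}$ of the anchor map, such that $\nabla(\Theta)\subset\mathcal E^{-1}_{\mathcal F}$ and for every $\alpha\in\Gamma$ the composition $\Theta\to\mathcal E^{-1}_{\mathcal F}\to\mathcal E^{-1}_{\mathcal F}/\mathcal E_{\mathcal F}\to\mathfrak g^{-\alpha}_{\mathcal F}$ is an isomorphism. An automorphism of $(\mathcal F,\nabla)$ is an automorphism of the $B$-bundle $\mathcal F$ whose induced action on $\mathcal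 F\times^B G$ preserves $\nabla$. Proposition. Every automorphism of a $\mathfrak g$-oper $(\mathcal F,\nabla)$ on $Y$ is the identity. -/

import Mathlib

open CategoryTheory AlgebraicGeometry TopologicalSpace Opposite
open scoped TensorProduct

namespace Opers

noncomputable section

/-! ### Linear algebraic groups inside `GL(𝔤)` and their points -/

section Points

variable {𝔤 : Type*} [AddCommGroup 𝔤] [Module ℂ 𝔤]
variable (R : Type*) [CommRing R] [Algebra ℂ R]
variable {R' : Type*} [CommRing R'] [Algebra ℂ R']

/-- Indices for the generators of the coordinate ring of `GL(𝔤)`: the matrix coefficients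
`φ ↦ ⟨l, φ x⟩` (left summand) and `φ ↦ ⟨l, φ⁻¹ x⟩` (right summand). -/
abbrev Coord (𝔤 : Type*) [AddCommGroup 𝔤] [Module ℂ 𝔤] : Type _ :=
  (𝔤 × Module.Dual ℂ 𝔤) ⊕ (𝔤 × Module.Dual ℂ 𝔤)

/-- The `R`-linear extension `R ⊗ 𝔤 → R` of a linear form on `𝔤`. -/
def dualExt (l : Module.Dual ℂ 𝔤) : R ⊗[ℂ] 𝔤 →ₗ[R] R :=
  LinearMap.liftBaseChange R ((Algebra.linearMap ℂ R) ∘ₗ l)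

/-- Matrix coefficients of a `ℂ`-point of `GL(𝔤)`. -/
def coordC (σ : LinearMap.GeneralLinearGroup ℂ 𝔤) : Coord 𝔤 → ℂ
  | .inl (x, l) => l (σ.1 x)
  | .inr (x, l) => l (σ⁻¹.1 x)

/-- Matrix coefficients of an `R`-point of `GL(𝔤)`. -/
def coord (φ : LinearMap.GeneralLinearGroup R (R ⊗[ℂ] 𝔤)) : Coord 𝔤 → R
  | .inl (x, l) => dualExt R l (φ.1 (1 ⊗ₜ x))
  | .inr (x, l) => dualExt R l (φ⁻¹.1 (1 ⊗ₜ x))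

variable {R} in
/-- The extension `R ⊗ 𝔤 → R' ⊗ 𝔤` of a homomorphism `R → R'`. -/
def extMap (𝔤 : Type*) [AddCommGroup 𝔤] [Module ℂ 𝔤] (ρ : R →ₐ[ℂ] R') :
    R ⊗[ℂ] 𝔤 →ₗ[ℂ] R' ⊗[ℂ] 𝔤 :=
  LinearMap.rTensor 𝔤 ρ.toLinearMap

variable {R}

@[simp] lemma dualExt_tmul (l : Module.Dual ℂ 𝔤) (r : R) (x : 𝔤) :
    dualExt R l (r ⊗ₜ x) = r * algebraMap ℂ R (l x) := by
  simp [dualExt]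

@[simp] lemma extMap_tmul (ρ : R →ₐ[ℂ] R') (r : R) (x : 𝔤) :
    extMap 𝔤 ρ (r ⊗ₜ x) = ρ r ⊗ₜ x := by
  simp [extMap]

lemma extMap_smul (ρ : R →ₐ[ℂ] R') (r : R) (y : R ⊗[ℂ] 𝔤) :
    extMap 𝔤 ρ (r • y) = ρ r • extMap 𝔤 ρ y := by
  induction y with
  | zero => simp
  | tmul a x => simp [TensorProduct.smul_tmul']
  | add y z hy hz => simp [smul_add, hy, hz]

lemma dualExt_extMap (ρ : R →ₐ[ℂ] R') (l : Module.Dual ℂ 𝔤) (y : R ⊗[ℂ] 𝔤) :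
    dualExt R' l (extMap 𝔤 ρ y) = ρ (dualExt R l y) := by
  induction y with
  | zero => simp
  | tmul a x => simp
  | add y z hy hz => simp [hy, hz]

/-- The extension of scalars of an `R`-linear endomorphism of `R ⊗ 𝔤` along `R → R'`. -/
def endExt (ρ : R →ₐ[ℂ] R') (φ : Module.End R (R ⊗[ℂ] 𝔤)) : Module.End R' (R' ⊗[ℂ] 𝔤) :=
  LinearMap.liftBaseChange R'
    (extMap 𝔤 ρ ∘ₗ φ.restrictScalars ℂ ∘ₗ TensorProduct.mk ℂ R 𝔤 1)

@[simp] lemma endExt_tmul (ρ : R →ₐ[ℂ] R') (φ : Module.End R (R ⊗[ℂ] 𝔤)) (r : R') (x : 𝔤) :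
    endExt ρ φ (r ⊗ₜ x) = r • extMap 𝔤 ρ (φ (1 ⊗ₜ x)) := by
  simp [endExt]

lemma endExt_extMap (ρ : R →ₐ[ℂ] R') (φ : Module.End R (R ⊗[ℂ] 𝔤)) (y : R ⊗[ℂ] 𝔤) :
    endExt ρ φ (extMap 𝔤 ρ y) = extMap 𝔤 ρ (φ y) := by
  induction y with
  | zero => simp
  | tmul a x =>
    have : (a ⊗ₜ[ℂ] x : R ⊗[ℂ] 𝔤) = a • ((1 : R) ⊗ₜ[ℂ] x) := by simp [TensorProduct.smul_tmul']
    rw [this, extMap_smul, LinearMap.map_smul φ, extMap_smul, LinearMap.map_smul (endExt ρ φ)]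
    simp
  | add y z hy hz => simp [hy, hz]

/-- Restriction of points `GL(R ⊗ 𝔤) → GL(R' ⊗ 𝔤)` along `R → R'`. -/
def glExt (𝔤 : Type*) [AddCommGroup 𝔤] [Module ℂ 𝔤] (ρ : R →ₐ[ℂ] R') :
    LinearMap.GeneralLinearGroup R (R ⊗[ℂ] 𝔤) →*
      LinearMap.GeneralLinearGroup R' (R' ⊗[ℂ] 𝔤) :=
  Units.map
    { toFun := endExt ρ
      map_one' := by
        ext x
        simp
      map_mul' := fun φ ψ => by
        ext x
        simp [endExt_extMap] }

@[simp] lemma glExt_val (ρ : R →ₐ[ℂ] R') (φ : LinearMap.GeneralLinearGroup R (R ⊗[ℂ] 𝔤)) :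
    (glExt 𝔤 ρ φ).1 = endExt ρ φ.1 := rfl

@[simp] lemma glExt_inv_val (ρ : R →ₐ[ℂ] R') (φ : LinearMap.GeneralLinearGroup R (R ⊗[ℂ] 𝔤)) :
    (glExt 𝔤 ρ φ)⁻¹.1 = endExt ρ φ⁻¹.1 := rfl

lemma coord_glExt (ρ : R →ₐ[ℂ] R') (φ : LinearMap.GeneralLinearGroup R (R ⊗[ℂ] 𝔤))
    (c : Coord 𝔤) : coord R' (glExt 𝔤 ρ φ) c = ρ (coord R φ c) := by
  rcases c with ⟨x, l⟩ | ⟨x, l⟩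
  · simp only [coord, glExt_val, endExt_tmul, one_smul, dualExt_extMap]
  · simp only [coord, glExt_inv_val, endExt_tmul, one_smul, dualExt_extMap]

/-- The polynomial `f` in the generators of the coordinate ring of `GL(𝔤)` vanishes on `S`. -/
def VanishesOn (S : Subgroup (LinearMap.GeneralLinearGroup ℂ 𝔤))
    (f : MvPolynomial (Coord 𝔤) ℂ) : Prop :=
  ∀ σ ∈ S, MvPolynomial.aeval (coordC σ) f = 0

/-- A polynomial with coefficients in `R` that vanishes on `S` vanishes on every `R`-point. -/
lemma eval_eq_zero_of_vanishes (S : Subgroup (LinearMap.GeneralLinearGroup ℂ 𝔤))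
    (v : Coord 𝔤 → R)
    (hv : ∀ f, VanishesOn S f → MvPolynomial.aeval v f = 0)
    (F : MvPolynomial (Coord 𝔤) R)
    (hF : ∀ σ ∈ S, MvPolynomial.eval (fun c => algebraMap ℂ R (coordC σ c)) F = 0) :
    MvPolynomial.eval v F = 0 := by
  classical
  let b := Module.Basis.ofVectorSpace ℂ R
  let Fi : Module.Basis.ofVectorSpaceIndex ℂ R → MvPolynomial (Coord 𝔤) ℂ := fun i =>
    ∑ m ∈ F.support, MvPolynomial.monomial m (b.repr (F.coeff m) i)
  have hFi : ∀ i, VanishesOn S (Fi i) := by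
    intro i σ hσ
    have h := hF σ hσ
    rw [MvPolynomial.eval_eq] at h
    have h2 := congrArg (fun r => b.repr r i) h
    simp only [map_sum, Finsupp.coe_finsetSum, Finset.sum_apply, map_zero,
      Finsupp.coe_zero, Pi.zero_apply] at h2
    simp only [Fi, map_sum, MvPolynomial.aeval_monomial]
    rw [← h2]
    refine Finset.sum_congr rfl fun m _ => ?_
    have h3 : F.coeff m * ∏ c ∈ m.support, algebraMap ℂ R (coordC σ c) ^ m c =
        (∏ c ∈ m.support, coordC σ c ^ m c) • F.coeff m := by
      rw [Algebra.smul_def, map_prod, mul_comm]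
      simp
    rw [h3, map_smul]
    simp [Finsupp.prod, mul_comm]
  have hz := fun i => hv (Fi i) (hFi i)
  rw [MvPolynomial.eval_eq]
  have key : ∀ m ∈ F.support, F.coeff m * ∏ c ∈ m.support, v c ^ m c =
      ∑ i ∈ F.support.biUnion (fun m => (b.repr (F.coeff m)).support),
        b i * (algebraMap ℂ R (b.repr (F.coeff m) i) * ∏ c ∈ m.support, v c ^ m c) := by
    intro m hm
    have h1 : F.coeff m = ∑ i ∈ F.support.biUnion (fun m => (b.repr (F.coeff m)).support),
        b.repr (F.coeff m) i • b i := by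
      conv_lhs => rw [← b.linearCombination_repr (F.coeff m)]
      rw [Finsupp.linearCombination_apply, Finsupp.sum]
      refine Finset.sum_subset (Finset.subset_biUnion_of_mem
        (fun m => (b.repr (F.coeff m)).support) hm) fun i _ hi => ?_
      simp [Finsupp.notMem_support_iff.mp hi]
    conv_lhs => rw [h1]
    rw [Finset.sum_mul]
    refine Finset.sum_congr rfl fun i _ => ?_
    rw [Algebra.smul_def]
    ring
  rw [Finset.sum_congr rfl key, Finset.sum_comm]
  refine Finset.sum_eq_zero fun i _ => ?_
  have := hz i
  simp only [Fi, map_sum, MvPolynomial.aeval_monomial, Finsupp.prod] at this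
  rw [← Finset.mul_sum, this, mul_zero]

lemma eq_sum_dualExt [FiniteDimensional ℂ 𝔤] (y : R ⊗[ℂ] 𝔤) :
    y = ∑ j, dualExt R ((Module.finBasis ℂ 𝔤).coord j) y ⊗ₜ[ℂ] (Module.finBasis ℂ 𝔤 j) := by
  induction y with
  | zero => simp
  | tmul a x =>
    conv_lhs => rw [← (Module.finBasis ℂ 𝔤).sum_repr x]
    rw [TensorProduct.tmul_sum]
    refine Finset.sum_congr rfl fun j _ => ?_
    rw [TensorProduct.tmul_smul, TensorProduct.smul_tmul', dualExt_tmul, Algebra.smul_def, mul_comm]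
    rfl
  | add y z hy hz =>
    conv_lhs => rw [hy, hz]
    simp only [map_add, TensorProduct.add_tmul, Finset.sum_add_distrib]

lemma dualExt_apply_eq_sum [FiniteDimensional ℂ 𝔤] (φ : Module.End R (R ⊗[ℂ] 𝔤))
    (l : Module.Dual ℂ 𝔤) (y : R ⊗[ℂ] 𝔤) :
    dualExt R l (φ y) = ∑ j, dualExt R ((Module.finBasis ℂ 𝔤).coord j) y *
      dualExt R l (φ (1 ⊗ₜ (Module.finBasis ℂ 𝔤 j))) := by
  conv_lhs => rw [eq_sum_dualExt y]
  simp only [map_sum]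
  refine Finset.sum_congr rfl fun j _ => ?_
  have : ∀ r : R, (r ⊗ₜ[ℂ] (Module.finBasis ℂ 𝔤 j) : R ⊗[ℂ] 𝔤) =
      r • ((1 : R) ⊗ₜ[ℂ] (Module.finBasis ℂ 𝔤 j)) := by
    intro r; simp [TensorProduct.smul_tmul']
  rw [this, map_smul, map_smul, smul_eq_mul]

/-- The `R`-points of the algebraic subgroup of `GL(𝔤)` whose group of `ℂ`-points is the
(Zariski closed) subgroup `S`: the elements of `GL(R ⊗ 𝔤)` killed by all regular functions on
`GL(𝔤)` that vanish on `S`. -/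
def points [FiniteDimensional ℂ 𝔤] (S : Subgroup (LinearMap.GeneralLinearGroup ℂ 𝔤))
    (R : Type*) [CommRing R] [Algebra ℂ R] :
    Subgroup (LinearMap.GeneralLinearGroup R (R ⊗[ℂ] 𝔤)) where
  carrier := {φ | ∀ f, VanishesOn S f → MvPolynomial.aeval (coord R φ) f = 0}
  one_mem' := by
    intro f hf
    have h := hf 1 S.one_mem
    have : coord R (1 : LinearMap.GeneralLinearGroup R (R ⊗[ℂ] 𝔤)) =
        algebraMap ℂ R ∘ coordC 1 := by
      funext c
      rcases c with ⟨x, l⟩ | ⟨x, l⟩ <;> simp [coord, coordC]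
    rw [this, MvPolynomial.aeval_algebraMap_apply, h, map_zero]
  inv_mem' := by
    intro φ hφ f hf
    have h : ∀ ψ : LinearMap.GeneralLinearGroup R (R ⊗[ℂ] 𝔤),
        coord R ψ⁻¹ = coord R ψ ∘ Sum.swap := by
      intro ψ
      funext c
      rcases c with ⟨x, l⟩ | ⟨x, l⟩ <;> simp [coord]
    have hC : ∀ σ : LinearMap.GeneralLinearGroup ℂ 𝔤,
        coordC σ⁻¹ = coordC σ ∘ Sum.swap := by
      intro ψ
      funext c
      rcases c with ⟨x, l⟩ | ⟨x, l⟩ <;> simp [coordC]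
    rw [h, ← MvPolynomial.aeval_rename]
    refine hφ _ fun σ hσ => ?_
    rw [MvPolynomial.aeval_rename, ← hC]
    exact hf _ (S.inv_mem hσ)
  mul_mem' := by
    intro φ ψ hφ hψ f hf
    let Q : Coord 𝔤 → MvPolynomial (Coord 𝔤) R
      | .inl (x, l) => ∑ j, MvPolynomial.C (coord R ψ (.inl (x, (Module.finBasis ℂ 𝔤).coord j))) *
          MvPolynomial.X (.inl (Module.finBasis ℂ 𝔤 j, l))
      | .inr (x, l) => ∑ j, MvPolynomial.X (.inr (x, (Module.finBasis ℂ 𝔤).coord j)) *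
          MvPolynomial.C (coord R ψ (.inr (Module.finBasis ℂ 𝔤 j, l)))
    have hQ : ∀ χ : LinearMap.GeneralLinearGroup R (R ⊗[ℂ] 𝔤), ∀ c,
        coord R (χ * ψ) c = MvPolynomial.eval (coord R χ) (Q c) := by
      intro χ c
      rcases c with ⟨x, l⟩ | ⟨x, l⟩
      · simp only [coord, Q, map_sum, map_mul, MvPolynomial.eval_C, MvPolynomial.eval_X,
          Units.val_mul, Module.End.mul_apply]
        exact dualExt_apply_eq_sum _ _ _
      · simp only [coord, Q, map_sum, map_mul, MvPolynomial.eval_C, MvPolynomial.eval_X,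
          Units.val_mul, Module.End.mul_apply, mul_inv_rev]
        exact dualExt_apply_eq_sum _ _ _
    have hQ' : ∀ χ : LinearMap.GeneralLinearGroup R (R ⊗[ℂ] 𝔤),
        MvPolynomial.aeval (coord R (χ * ψ)) f =
          MvPolynomial.eval (coord R χ) (MvPolynomial.aeval Q f) := by
      intro χ
      rw [show coord R (χ * ψ) = fun c => MvPolynomial.eval (coord R χ) (Q c) from funext (hQ χ)]
      have : (MvPolynomial.aeval fun c => MvPolynomial.eval (coord R χ) (Q c)) =
          (((MvPolynomial.aeval (coord R χ) : MvPolynomial (Coord 𝔤) R →ₐ[R] R).restrictScalars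
            ℂ).comp (MvPolynomial.aeval Q) : MvPolynomial (Coord 𝔤) ℂ →ₐ[ℂ] R) := by
        ext c
        simp [MvPolynomial.aeval_eq_eval]
      rw [this]
      simp [MvPolynomial.aeval_eq_eval]
    rw [hQ']
    refine eval_eq_zero_of_vanishes S _ hφ _ fun σ hσ => ?_
    let σR : LinearMap.GeneralLinearGroup R (R ⊗[ℂ] 𝔤) :=
      Units.map ((Module.End.baseChangeHom ℂ R 𝔤 : Module.End ℂ 𝔤 →* _)) σ
    have hσR : ∀ y : R ⊗[ℂ] 𝔤, σR.1 y = LinearMap.baseChange R σ.1 y := fun _ => rfl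
    have hσR' : ∀ y : R ⊗[ℂ] 𝔤, σR⁻¹.1 y = LinearMap.baseChange R σ⁻¹.1 y := fun _ => rfl
    have hc : (fun c => algebraMap ℂ R (coordC σ c)) = coord R σR := by
      funext c
      rcases c with ⟨x, l⟩ | ⟨x, l⟩
      · simp [coord, coordC, hσR]
      · simp only [coord, coordC, hσR']
        simp
    rw [hc, ← hQ']
    let r : Coord 𝔤 → Coord 𝔤
      | .inl (x, l) => .inl (x, l ∘ₗ σ.1)
      | .inr (x, l) => .inr (σ⁻¹.1 x, l)
    have hdual : ∀ (l : Module.Dual ℂ 𝔤) (y : R ⊗[ℂ] 𝔤),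
        dualExt R l (LinearMap.baseChange R σ.1 y) = dualExt R (l ∘ₗ σ.1) y := by
      intro l y
      induction y with
      | zero => simp
      | tmul a x => simp
      | add y z hy hz => simp only [map_add, hy, hz]
    have hr : coord R (σR * ψ) = coord R ψ ∘ r := by
      funext c
      rcases c with ⟨x, l⟩ | ⟨x, l⟩
      · simp only [coord, r, Function.comp, Units.val_mul, Module.End.mul_apply, hσR, hdual]
      · simp only [coord, r, Function.comp, mul_inv_rev, Units.val_mul, Module.End.mul_apply,
          hσR', LinearMap.baseChange_tmul]
    rw [hr, ← MvPolynomial.aeval_rename]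
    refine hψ _ fun τ hτ => ?_
    have hr' : coordC τ ∘ r = coordC (σ * τ) := by
      funext c
      rcases c with ⟨x, l⟩ | ⟨x, l⟩
      · simp [coordC, r]
      · simp only [coordC, r, Function.comp, mul_inv_rev, Units.val_mul, Module.End.mul_apply]
    rw [MvPolynomial.aeval_rename, hr']
    exact hf _ (S.mul_mem hσ hτ)

lemma points_mono [FiniteDimensional ℂ 𝔤] {S T : Subgroup (LinearMap.GeneralLinearGroup ℂ 𝔤)}
    (h : S ≤ T) (R : Type*) [CommRing R] [Algebra ℂ R] : points S R ≤ points T R :=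
  fun _ hφ f hf => hφ f fun σ hσ => hf σ (h hσ)

/-- Restriction of points `S(R) → S(R')` along `R → R'`. -/
def pointsExt [FiniteDimensional ℂ 𝔤] (S : Subgroup (LinearMap.GeneralLinearGroup ℂ 𝔤))
    (ρ : R →ₐ[ℂ] R') : points S R →* points S R' :=
  ((glExt 𝔤 ρ).comp (points S R).subtype).codRestrict (points S R') fun φ f hf => by
    have : coord R' (glExt 𝔤 ρ φ.1) = ρ ∘ coord R φ.1 := funext (coord_glExt ρ φ.1)
    show MvPolynomial.aeval (coord R' (glExt 𝔤 ρ φ.1)) f = 0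
    rw [this, show ρ ∘ coord R φ.1 = fun c => ρ (coord R φ.1 c) from rfl,
      ← MvPolynomial.comp_aeval_apply, φ.2 f hf, map_zero]

end Points
/-! ### The adjoint group, its Borel and Cartan subgroups, and the principal filtration -/

section Lie

variable {𝔤 : Type*} [LieRing 𝔤] [LieAlgebra ℂ 𝔤] [FiniteDimensional ℂ 𝔤]
  [LieAlgebra.IsSemisimple ℂ 𝔤]
  {H : LieSubalgebra ℂ 𝔤} [H.IsCartanSubalgebra]
  (Δ : (LieAlgebra.IsKilling.rootSystem H).Base)

/-- The simple roots `α ∈ Γ`, as linear forms on `𝔥`. -/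
def simpleRoot (i : Δ.support) : Module.Dual ℂ H :=
  (LieAlgebra.IsKilling.rootSystem H).root i

/-- The component `𝔤_k` of the principal grading: the sum of the root spaces of the
`∑ nᵢ αᵢ` with `∑ nᵢ = k`. So `𝔤_0 = 𝔥` and `𝔤_{±1}` is the sum of the `𝔤^{±α}`, `α` simple. -/
def gradedPiece (k : ℤ) : Submodule ℂ 𝔤 :=
  ⨆ (n : Δ.support → ℤ) (_ : ∑ i, n i = k),
    (LieAlgebra.rootSpace H ⇑(∑ i, n i • simpleRoot Δ i)).toSubmodule

/-- The filtration `𝔤^k = ⨁_{r ≥ k} 𝔤_r`. Here `𝔤^0 = 𝔟` is the Borel subalgebra defined by the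
base and `𝔤^1 = [𝔟, 𝔟]`. -/
def filtration (k : ℤ) : Submodule ℂ 𝔤 :=
  ⨆ (r : ℤ) (_ : k ≤ r), gradedPiece Δ r

lemma isCompl_rootSpace {𝔤 : Type*} [LieRing 𝔤] [LieAlgebra ℂ 𝔤] [FiniteDimensional ℂ 𝔤]
    (H : LieSubalgebra ℂ 𝔤) [H.IsCartanSubalgebra] (χ : H → ℂ) :
    IsCompl (LieAlgebra.rootSpace H χ).toSubmodule
      (⨆ (ψ : H → ℂ) (_ : ψ ≠ χ), (LieAlgebra.rootSpace H ψ).toSubmodule) := by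
  have hi := LieModule.iSupIndep_genWeightSpace ℂ H 𝔤
  rw [← LieSubmodule.iSupIndep_toSubmodule] at hi
  have ht := congrArg LieSubmodule.toSubmodule (LieModule.iSup_genWeightSpace_eq_top ℂ H 𝔤)
  rw [LieSubmodule.iSup_toSubmodule, LieSubmodule.top_toSubmodule] at ht
  refine ⟨hi χ, codisjoint_iff.mpr (top_le_iff.mp ?_)⟩
  rw [← ht]
  refine iSup_le fun ψ => ?_
  by_cases h : ψ = χ
  · subst h
    exact le_sup_left
  · exact le_sup_of_le_right (le_iSup₂_of_le ψ h le_rfl)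

/-- The projection `𝔤 → 𝔤^χ ⊆ 𝔤` along the other root spaces. -/
def rootProj {𝔤 : Type*} [LieRing 𝔤] [LieAlgebra ℂ 𝔤] [FiniteDimensional ℂ 𝔤]
    (H : LieSubalgebra ℂ 𝔤) [H.IsCartanSubalgebra] (χ : H → ℂ) : 𝔤 →ₗ[ℂ] 𝔤 :=
  Submodule.projection _ _ (isCompl_rootSpace H χ)

/-- `ad x` is nilpotent and `σ = exp (ad x)`. -/
def IsExpAd (x : 𝔤) (σ : LinearMap.GeneralLinearGroup ℂ 𝔤) : Prop :=
  ∃ k : ℕ, LieAlgebra.ad ℂ 𝔤 x ^ k = 0 ∧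
    σ.1 = ∑ n ∈ Finset.range k, (n.factorial : ℂ)⁻¹ • LieAlgebra.ad ℂ 𝔤 x ^ n

/-- The adjoint group `G`: the group of inner automorphisms of `𝔤`, generated by the `exp (ad x)`
with `ad x` nilpotent. -/
def adjointGroup (𝔤 : Type*) [LieRing 𝔤] [LieAlgebra ℂ 𝔤] :
    Subgroup (LinearMap.GeneralLinearGroup ℂ 𝔤) :=
  Subgroup.closure {σ | ∃ x : 𝔤, IsExpAd x σ}

/-- The Cartan subgroup of `G` with Lie algebra `𝔥`: the centralizer of `𝔥` in `G`. -/
def cartanSubgroup (H : LieSubalgebra ℂ 𝔤) : Subgroup (LinearMap.GeneralLinearGroup ℂ 𝔤) where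
  carrier := {σ | σ ∈ adjointGroup 𝔤 ∧ ∀ h ∈ H, σ.1 h = h}
  one_mem' := ⟨Subgroup.one_mem _, fun h _ => by simp⟩
  mul_mem' := fun {σ τ} hσ hτ => ⟨Subgroup.mul_mem _ hσ.1 hτ.1, fun h hh => by
    rw [Units.val_mul, Module.End.mul_apply, hτ.2 h hh, hσ.2 h hh]⟩
  inv_mem' := fun {σ} hσ => ⟨Subgroup.inv_mem _ hσ.1, fun h hh => by
    conv_lhs => rw [← hσ.2 h hh]
    rw [← Module.End.mul_apply, ← Units.val_mul, inv_mul_cancel, Units.val_one,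
      Module.End.one_apply]⟩

/-- The Borel subgroup of `G` with Lie algebra `𝔟`: it is generated by the Cartan subgroup and the
unipotent elements `exp (ad x)`, `x ∈ [𝔟, 𝔟]`. -/
def borelSubgroup : Subgroup (LinearMap.GeneralLinearGroup ℂ 𝔤) :=
  cartanSubgroup H ⊔ Subgroup.closure {σ | ∃ x ∈ filtration Δ 1, IsExpAd x σ}

lemma borelSubgroup_le : borelSubgroup Δ ≤ adjointGroup 𝔤 :=
  sup_le (fun _ h => h.1) (Subgroup.closure_mono fun _ ⟨x, _, h⟩ => ⟨x, h⟩)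

end Lie

/-! ### Spaces with a structure sheaf of `ℂ`-algebras -/

/-- The structure sheaf of a scheme over `ℂ`, as a presheaf of `ℂ`-algebras. -/
def structureSheaf {Y : Scheme.{0}} (π : Y ⟶ Spec (CommRingCat.of ℂ)) :
    TopCat.Presheaf (CommAlgCat.{0} ℂ) Y.toTopCat where
  obj U :=
    letI : Algebra ℂ Γ(Y, U.unop) :=
      ((Scheme.ΓSpecIso (CommRingCat.of ℂ)).inv ≫ π.appLE ⊤ U.unop le_top).hom.toAlgebra
    CommAlgCat.of ℂ Γ(Y, U.unop)
  map {U V} i :=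
    letI : Algebra ℂ Γ(Y, U.unop) :=
      ((Scheme.ΓSpecIso (CommRingCat.of ℂ)).inv ≫ π.appLE ⊤ U.unop le_top).hom.toAlgebra
    letI : Algebra ℂ Γ(Y, V.unop) :=
      ((Scheme.ΓSpecIso (CommRingCat.of ℂ)).inv ≫ π.appLE ⊤ V.unop le_top).hom.toAlgebra
    CommAlgCat.ofHom
      { (Y.presheaf.map i).hom with
        commutes' := fun c => by
          have := π.appLE_map (U := ⊤) (V := U.unop) (V' := V.unop) le_top i
          exact congrArg (fun f => f.hom ((Scheme.ΓSpecIso (CommRingCat.of ℂ)).inv.hom c)) this }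
  map_id U := by
    refine CommAlgCat.hom_ext ?_
    refine @AlgHom.ext _ _ _ _ _ _ (_) (_) _ _ fun x => ?_
    exact congrArg (fun f => f.hom x) (Y.presheaf.map_id U)
  map_comp i j := by
    refine CommAlgCat.hom_ext ?_
    refine @AlgHom.ext _ _ _ _ _ _ (_) (_) _ _ fun x => ?_
    exact congrArg (fun f => f.hom x) (Y.presheaf.map_comp i j)

section Geometry

universe w u

variable {X : TopCat.{0}} (O : TopCat.Presheaf (CommAlgCat.{0} ℂ) X)

/-- Restriction of functions. -/
def resO {U V : Opens X} (h : V ≤ U) : O.obj (op U) →ₐ[ℂ] O.obj (op V) :=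
  (O.map (homOfLE h).op).hom

/-- Sections over `U` of the sheaf `Θ` of vector fields, i.e. of `ℂ`-linear derivations of the
structure sheaf. -/
@[ext]
structure VectorField (U : Opens X) where
  der : ∀ V : Opens X, V ≤ U → Derivation ℂ (O.obj (op V)) (O.obj (op V))
  der_res : ∀ (V W : Opens X) (hV : V ≤ U) (hW : W ≤ V) (f : O.obj (op V)),
    der W (hW.trans hV) (resO O hW f) = resO O hW (der V hV f)

namespace VectorField

variable {O} {U : Opens X}

instance : Add (VectorField O U) where
  add θ η :=
    { der := fun V hV => θ.der V hV + η.der V hV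
      der_res := fun V W hV hW f => by simp [θ.der_res V W hV hW, η.der_res V W hV hW] }

lemma resO_resO {U V W : Opens X} (hV : V ≤ U) (hW : W ≤ V) (f : O.obj (op U)) :
    resO O hW (resO O hV f) = resO O (hW.trans hV) f := by
  have := O.map_comp (homOfLE hV).op (homOfLE hW).op
  exact (congrArg (fun g => g.hom f) this).symm

instance : SMul (O.obj (op U)) (VectorField O U) where
  smul f θ :=
    { der := fun V hV => resO O hV f • θ.der V hV
      der_res := fun V W hV hW g => by
        simp [θ.der_res V W hV hW, resO_resO] }

/-- Restriction of vector fields. -/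
def restrict (θ : VectorField O U) {V : Opens X} (hV : V ≤ U) : VectorField O V where
  der W hW := θ.der W (hW.trans hV)
  der_res W W' hW hW' f := θ.der_res W W' (hW.trans hV) hW' f

end VectorField

variable {𝔤 : Type u} [LieRing 𝔤] [LieAlgebra ℂ 𝔤] [FiniteDimensional ℂ 𝔤]

/-- A presheaf of sets on `X` with a right action of the sheaf of groups `U ↦ S(O(U))`. -/
structure GSpace (S : Subgroup (LinearMap.GeneralLinearGroup ℂ 𝔤)) where
  sec : Opens X → Type w
  res : ∀ {U V : Opens X}, V ≤ U → sec U → sec V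
  res_self : ∀ {U : Opens X} (s : sec U), res le_rfl s = s
  res_res : ∀ {U V W : Opens X} (hV : V ≤ U) (hW : W ≤ V) (s : sec U),
    res hW (res hV s) = res (hW.trans hV) s
  act : ∀ {U : Opens X}, sec U → points S (O.obj (op U)) → sec U
  act_one : ∀ {U : Opens X} (s : sec U), act s 1 = s
  act_mul : ∀ {U : Opens X} (s : sec U) (b c : points S (O.obj (op U))),
    act s (b * c) = act (act s b) c
  res_act : ∀ {U V : Opens X} (h : V ≤ U) (s : sec U) (b : points S (O.obj (op U))),
    res h (act s b) = act (res h s) (pointsExt S (resO O h) b)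

/-- The underlying presheaf of sets. -/
def GSpace.presheaf {O : TopCat.Presheaf (CommAlgCat.{0} ℂ) X}
    {S : Subgroup (LinearMap.GeneralLinearGroup ℂ 𝔤)} (P : GSpace.{w} O S) :
    TopCat.Presheaf (Type w) X where
  obj U := P.sec U.unop
  map i := TypeCat.ofHom (P.res i.unop.le)
  map_id U := by
    ext s
    exact P.res_self s
  map_comp i j := by
    ext s
    exact (P.res_res i.unop.le j.unop.le s).symm

/-- A principal bundle for the algebraic group `S`, given by its sheaf of sections: a sheaf of sets
with a simply transitive right action of `U ↦ S(O(U))` that locally has sections. -/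
structure PrincipalBundle (S : Subgroup (LinearMap.GeneralLinearGroup ℂ 𝔤)) extends
    GSpace.{w} O S where
  isSheaf : toGSpace.presheaf.IsSheaf
  simply_transitive : ∀ {U : Opens X} (s t : sec U),
    ∃! b : points S (O.obj (op U)), act s b = t
  locally_nonempty : ∀ x : X, ∃ U : Opens X, x ∈ U ∧ Nonempty (sec U)

variable {O}

namespace GSpace

variable {S T : Subgroup (LinearMap.GeneralLinearGroup ℂ 𝔤)} (F : GSpace.{w} O S)

/-- Sections over `U` of `F ×^S T`. A section `p` is recorded by the functions `val` with
`p = s · val(s)`, for `s` a local section of `F`; thus `val(s · b) = b⁻¹ val(s)`. -/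
@[ext]
structure InducedSec (hST : S ≤ T) (U : Opens X) : Type (max u w) where
  val : ∀ V : Opens X, V ≤ U → F.sec V → points T (O.obj (op V))
  val_res : ∀ (V W : Opens X) (hV : V ≤ U) (hW : W ≤ V) (s : F.sec V),
    val W (hW.trans hV) (F.res hW s) = pointsExt T (resO O hW) (val V hV s)
  val_act : ∀ (V : Opens X) (hV : V ≤ U) (s : F.sec V) (b : points S (O.obj (op V))),
    val V hV (F.act s b) = (Subgroup.inclusion (points_mono hST _) b)⁻¹ * val V hV s

lemma pointsExt_resO (T : Subgroup (LinearMap.GeneralLinearGroup ℂ 𝔤)) {U V W : Opens X}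
    (hV : V ≤ U) (hW : W ≤ V) (k : points T (O.obj (op U))) :
    pointsExt T (resO O hW) (pointsExt T (resO O hV) k) =
      pointsExt T (resO O (hW.trans hV)) k := by
  refine Subtype.ext (Units.ext ?_)
  refine TensorProduct.AlgebraTensorModule.curry_injective ?_
  ext x
  show endExt (resO O hW) (endExt (resO O hV) k.1.1) (1 ⊗ₜ x) =
    endExt (resO O (hW.trans hV)) k.1.1 (1 ⊗ₜ x)
  simp only [endExt_tmul, one_smul]
  generalize k.1.1 (1 ⊗ₜ x) = y
  induction y with
  | zero => simp
  | tmul a z => simp [VectorField.resO_resO]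
  | add y z hy hz => simp [hy, hz]

/-- The `T`-bundle `F ×^S T` induced by an `S`-bundle `F`, for `S ≤ T`; the right action of `T` is
`(s · val(s)) · k = s · (val(s) k)`. -/
def induced (hST : S ≤ T) : GSpace.{max u w} O T where
  sec := F.InducedSec hST
  res h p :=
    { val := fun V hV => p.val V (hV.trans h)
      val_res := fun V W hV hW s => p.val_res V W (hV.trans h) hW s
      val_act := fun V hV s b => p.val_act V (hV.trans h) s b }
  res_self _ := rfl
  res_res _ _ _ := rfl
  act p k :=
    { val := fun V hV s => p.val V hV s * pointsExt T (resO O hV) k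
      val_res := fun V W hV hW s => by
        rw [p.val_res V W hV hW s, map_mul, pointsExt_resO]
      val_act := fun V hV s b => by rw [p.val_act V hV s b, mul_assoc] }
  act_one p := by
    ext V hV s : 4
    simp
  act_mul p k m := by
    ext V hV s : 4
    simp [mul_assoc]
  res_act h p k := by
    ext V hV s : 4
    simp [pointsExt_resO]

end GSpace

namespace PrincipalBundle

variable {S T : Subgroup (LinearMap.GeneralLinearGroup ℂ 𝔤)} (F : PrincipalBundle.{w} O S)

/-- The `b` with `s · b = t`. -/
def div {U : Opens X} (s t : F.sec U) : points S (O.obj (op U)) :=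
  (F.simply_transitive s t).choose

lemma act_div {U : Opens X} (s t : F.sec U) : F.act s (F.div s t) = t :=
  (F.simply_transitive s t).choose_spec.1

lemma eq_div {U : Opens X} {s t : F.sec U} {b : points S (O.obj (op U))}
    (h : F.act s b = t) : b = F.div s t :=
  (F.simply_transitive s t).choose_spec.2 b h

/-- The canonical map `F → F ×^S T`. -/
def toInduced (hST : S ≤ T) {U : Opens X} (t : F.sec U) : (F.induced hST).sec U where
  val V hV s := Subgroup.inclusion (points_mono hST _) (F.div s (F.res hV t))
  val_res V W hV hW s := by
    have : F.div (F.res hW s) (F.res (hW.trans hV) t) =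
        pointsExt S (resO O hW) (F.div s (F.res hV t)) := by
      refine (F.eq_div ?_).symm
      rw [← F.res_act, F.act_div, F.res_res]
    rw [this]
    rfl
  val_act V hV s b := by
    have : F.div (F.act s b) (F.res hV t) = b⁻¹ * F.div s (F.res hV t) := by
      refine (F.eq_div ?_).symm
      rw [← F.act_mul, mul_inv_cancel_left, F.act_div]
    rw [this, map_mul, map_inv]

/-- Isomorphisms of principal bundles. -/
@[ext]
structure Iso (F F' : PrincipalBundle.{w} O S) where
  toEquiv : ∀ U : Opens X, F.sec U ≃ F'.sec U
  map_res : ∀ {U V : Opens X} (h : V ≤ U) (s : F.sec U),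
    toEquiv V (F.res h s) = F'.res h (toEquiv U s)
  map_act : ∀ {U : Opens X} (s : F.sec U) (b : points S (O.obj (op U))),
    toEquiv U (F.act s b) = F'.act (toEquiv U s) b

/-- The identity isomorphism. -/
def Iso.refl : Iso F F where
  toEquiv _ := Equiv.refl _
  map_res _ _ := rfl
  map_act _ _ := rfl

variable {F} {F' : PrincipalBundle.{w} O S}

/-- The isomorphism `F ×^S T → F' ×^S T` induced by an isomorphism `f : F → F'`; it sends
`s · k` to `f(s) · k`. -/
def Iso.mapInduced (f : Iso F F') (hST : S ≤ T) {U : Opens X}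
    (p : (F.induced hST).sec U) : (F'.induced hST).sec U where
  val V hV s := GSpace.InducedSec.val p V hV ((f.toEquiv V).symm s)
  val_res V W hV hW s := by
    rw [← GSpace.InducedSec.val_res p V W hV hW]
    congr 1
    rw [Equiv.symm_apply_eq, f.map_res, Equiv.apply_symm_apply]
  val_act V hV s b := by
    rw [← GSpace.InducedSec.val_act p V hV]
    congr 1
    rw [Equiv.symm_apply_eq, f.map_act, Equiv.apply_symm_apply]

end PrincipalBundle

/-- The action of a derivation of `R` on `R ⊗ 𝔤`. -/
def derExt (𝔤 : Type*) [AddCommGroup 𝔤] [Module ℂ 𝔤] {R : Type*} [CommRing R] [Algebra ℂ R]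
    (D : Derivation ℂ R R) : R ⊗[ℂ] 𝔤 →ₗ[ℂ] R ⊗[ℂ] 𝔤 :=
  LinearMap.rTensor 𝔤 (D : R →ₗ[ℂ] R)

/-- Sections over `U` of the algebroid `ℰ_P` of infinitesimal symmetries of a bundle `P` for the
adjoint group. In the trivialization of `P` given by a local section `p` an infinitesimal symmetry
is `θ + A(p)`, with `θ` a vector field and `A(p)` a function with values in `𝔤`; if `p` is replaced
by `p · k` it becomes `k⁻¹ (θ + A(p)) k`, as operators in the adjoint representation. -/
@[ext]
structure InfSymm (P : GSpace.{w} O (adjointGroup 𝔤)) (U : Opens X) where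
  anchor : VectorField O U
  form : ∀ V : Opens X, V ≤ U → P.sec V → O.obj (op V) ⊗[ℂ] 𝔤
  form_res : ∀ (V W : Opens X) (hV : V ≤ U) (hW : W ≤ V) (p : P.sec V),
    form W (hW.trans hV) (P.res hW p) = extMap 𝔤 (resO O hW) (form V hV p)
  gauge : ∀ (V : Opens X) (hV : V ≤ U) (p : P.sec V)
    (k : points (adjointGroup 𝔤) (O.obj (op V))) (y : O.obj (op V) ⊗[ℂ] 𝔤),
    derExt 𝔤 (anchor.der V hV) y + ⁅form V hV (P.act p k), y⁆ =
      k⁻¹.1.1 (derExt 𝔤 (anchor.der V hV) (k.1.1 y) + ⁅form V hV p, k.1.1 y⁆)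

/-- A connection on `P`: an `O`-linear splitting `∇ : Θ → ℰ_P` of the anchor `ℰ_P → Θ`. -/
structure Connection (P : GSpace.{w} O (adjointGroup 𝔤)) where
  nabla : ∀ {U : Opens X}, VectorField O U → InfSymm P U
  anchor_nabla : ∀ {U : Opens X} (θ : VectorField O U), (nabla θ).anchor = θ
  nabla_add : ∀ {U : Opens X} (θ η : VectorField O U) (V : Opens X) (hV : V ≤ U)
    (p : P.sec V),
    (nabla (θ + η)).form V hV p = (nabla θ).form V hV p + (nabla η).form V hV p
  nabla_smul : ∀ {U : Opens X} (f : O.obj (op U)) (θ : VectorField O U) (V : Opens X) (hV : V ≤ U)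
    (p : P.sec V),
    (nabla (f • θ)).form V hV p = resO O hV f • (nabla θ).form V hV p
  nabla_restrict : ∀ {U V : Opens X} (hV : V ≤ U) (θ : VectorField O U) (W : Opens X) (hW : W ≤ V)
    (p : P.sec W),
    (nabla (θ.restrict hV)).form W hW p = (nabla θ).form W (hW.trans hV) p

/-! ### Opers -/

variable [LieAlgebra.IsSemisimple ℂ 𝔤] {H : LieSubalgebra ℂ 𝔤} [H.IsCartanSubalgebra]
  {Δ : (LieAlgebra.IsKilling.rootSystem H).Base}

/-- The `G`-bundle corresponding to a `B`-bundle. -/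
abbrev gBundle (F : PrincipalBundle.{w} O (borelSubgroup Δ)) :
    GSpace.{max u w} O (adjointGroup 𝔤) :=
  F.induced (borelSubgroup_le Δ)

/-- The step `ℰ^k_F`, `k ≤ 0`, of the filtration of the algebroid `ℰ^𝔤_F` of infinitesimal
symmetries of the `G`-bundle: in the trivialization given by any local section of `F` the
`𝔤`-component lies in `𝔤^k`. For `k = 0` these are the infinitesimal symmetries of `F`. -/
def MemFiltration (F : PrincipalBundle.{w} O (borelSubgroup Δ)) (k : ℤ) {U : Opens X}
    (e : InfSymm (gBundle F) U) : Prop :=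
  ∀ (V : Opens X) (hV : V ≤ U) (s : F.sec V),
    e.form V hV (F.toInduced (borelSubgroup_le Δ) s) ∈
      (filtration Δ k).baseChange (O.obj (op V))

/-- Sections over `U` of the twist `𝔤^{-α}_F`, `α` a simple root: functions `v` from the local
sections of `F` to `𝔤^{-α}` with `v(s · b) = b⁻¹ v(s)`. Here `B` acts on `𝔤^{-α}` as on the direct
summand `𝔤^{-α}` of `𝔤^{-1} / 𝔟`, which is the action through `B → H`. -/
def rootTwist (F : PrincipalBundle.{w} O (borelSubgroup Δ)) (i : Δ.support) (U : Opens X) :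
    Set (∀ V : Opens X, V ≤ U → F.sec V → O.obj (op V) ⊗[ℂ] 𝔤) :=
  {v | (∀ (V : Opens X) (hV : V ≤ U) (s : F.sec V),
      v V hV s ∈ (LieAlgebra.rootSpace H ⇑(-simpleRoot Δ i)).toSubmodule.baseChange
        (O.obj (op V))) ∧
    (∀ (V W : Opens X) (hV : V ≤ U) (hW : W ≤ V) (s : F.sec V),
      v W (hW.trans hV) (F.res hW s) = extMap 𝔤 (resO O hW) (v V hV s)) ∧
    (∀ (V : Opens X) (hV : V ≤ U) (s : F.sec V)
      (b : points (borelSubgroup Δ) (O.obj (op V))),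
      v V hV (F.act s b) =
        (rootProj H ⇑(-simpleRoot Δ i)).baseChange (O.obj (op V)) (b⁻¹.1.1 (v V hV s)))}

/-- The map `ℰ^{-1}_F → ℰ^{-1}_F / ℰ_F → 𝔤^{-α}_F`. -/
def rootComponent (F : PrincipalBundle.{w} O (borelSubgroup Δ)) (i : Δ.support) {U : Opens X}
    (e : InfSymm (gBundle F) U) :
    ∀ V : Opens X, V ≤ U → F.sec V → O.obj (op V) ⊗[ℂ] 𝔤 :=
  fun V hV s => (rootProj H ⇑(-simpleRoot Δ i)).baseChange (O.obj (op V))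
    (e.form V hV (F.toInduced (borelSubgroup_le Δ) s))

variable (O Δ) in
/-- A `𝔤`-oper: a `B`-bundle `F` with a connection `∇` on the corresponding `G`-bundle such that
`∇(Θ) ⊆ ℰ^{-1}_F` and, for every simple root `α`, the composition
`Θ → ℰ^{-1}_F → ℰ^{-1}_F / ℰ_F → 𝔤^{-α}_F` is an isomorphism of sheaves, where `G` is the adjoint
group of `𝔤`. -/
structure Oper where
  bundle : PrincipalBundle.{w} O (borelSubgroup Δ)
  conn : Connection (gBundle bundle)
  nabla_mem : ∀ {U : Opens X} (θ : VectorField O U), MemFiltration bundle (-1) (conn.nabla θ)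
  bijective : ∀ (i : Δ.support) (U : Opens X),
    Set.BijOn (fun θ : VectorField O U => rootComponent bundle i (conn.nabla θ)) Set.univ
      (rootTwist bundle i U)

namespace Oper

/-- Isomorphisms of opers: isomorphisms of `B`-bundles that are compatible with the
connections. -/
@[ext]
structure Iso (E E' : Oper.{w} O Δ) extends PrincipalBundle.Iso E.bundle E'.bundle where
  map_conn : ∀ {U : Opens X} (θ : VectorField O U) (V : Opens X) (hV : V ≤ U)
    (p : (gBundle E.bundle).sec V),
    (E'.conn.nabla θ).form V hV (toIso.mapInduced (borelSubgroup_le Δ) p) =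
      (E.conn.nabla θ).form V hV p

/-- The trivial automorphism of an oper. -/
def Iso.refl (E : Oper.{w} O Δ) : Iso E E where
  toIso := PrincipalBundle.Iso.refl E.bundle
  map_conn _ _ _ _ := rfl

end Oper

end Geometry

end

end Opers

/-! Over an open set `U` with a section `s` of the `B`-bundle, an automorphism has the form `s ↦ s ·
b` with `b ∈ B(R)`, `R = O(U)`. Compatibility with `∇` says that `b` commutes with `D + ad A` on `R
⊗ 𝔤`, where `A ∈ 𝔤^{-1}` (tensoring with `R` is tacit). The oper condition supplies a vector field
for which the `𝔤^{-αᵢ}`-components of `A` are `uᵢ fᵢ` with `uᵢ` units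
(`exists_vectorField_rootComponent_eq`). Since `G` is adjoint, `b` is a linear operator on `R ⊗ 𝔤`,
and everything reduces to `IsBorelAutomorphism.eq_one`: this operator is the identity.

No exponential coordinates on `B(R)` are needed. It suffices that `b` respects brackets and the
filtration `𝔤^k`, acts trivially on `𝔥` modulo `𝔤^1`, and sends `𝔤^{-α}` into `𝔤^{-α} + 𝔟`. These
conditions are polynomial in the matrix coefficients, so they pass from `B` to its `R`-points
(`isBorelAutomorphism_of_mem_points`).

Put `z = bA - A`, `y = bρ^∨ - ρ^∨ ∈ 𝔤^1`, `F = ∑ uᵢ fᵢ`. On constant vectors `x` the gauge equation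
is `D(bx - x) = [z, bx]`. Taking `x = ρ^∨` and using that `ad ρ^∨` is invertible in nonzero degrees
gives `z ∈ 𝔤^0`. Comparing terms of degree `-1` shows that `b` fixes each `fᵢ` modulo `𝔟`;
`𝔰𝔩₂`-theory then makes `b` trivial on the associated graded (`map_sub_mem_of_map_f`). Taking `x =
eᵢ` gives `z ∈ 𝔤^1`.

The last stage is an induction on `m` with `y ∈ 𝔤^m`. Then `b - 1` raises degrees by `m`
(`map_sub_mem_of_map_gradingElement`), so `z` and `bF - F` lie in `𝔤^m`. Applying `b` to `[ρ^∨, F] =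
-F` shows that the degree `m` part of `y` commutes with `F`, and it vanishes because `ad F` is
injective in positive degrees (`eq_zero_of_lie_principalF`). As the filtration is finite, `b = 1`.
-/

namespace Opers

noncomputable section

/-! ### The principal grading -/

section RootProjection

open LieAlgebra

variable {𝔤 : Type*} [LieRing 𝔤] [LieAlgebra ℂ 𝔤] [FiniteDimensional ℂ 𝔤]
  {H : LieSubalgebra ℂ 𝔤} [H.IsCartanSubalgebra]

lemma rootSpace_zero_toSubmodule : (rootSpace H (0 : H → ℂ)).toSubmodule = H.toSubmodule := by
  rw [rootSpace_zero_eq]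
  rfl

lemma rootProj_apply_of_mem {χ : H → ℂ} {x : 𝔤} (hx : x ∈ rootSpace H χ) :
    rootProj H χ x = x :=
  Submodule.projection_apply_of_mem_left _ hx

lemma rootProj_apply_of_ne {χ ψ : H → ℂ} (h : ψ ≠ χ) {x : 𝔤} (hx : x ∈ rootSpace H ψ) :
    rootProj H χ x = 0 :=
  (Submodule.projection_apply_eq_zero_iff _).mpr
    ((le_iSup₂_of_le (f := fun (ψ : H → ℂ) (_ : ψ ≠ χ) => (rootSpace H ψ).toSubmodule)
      ψ h le_rfl) hx)

lemma rootProj_mem (χ : H → ℂ) (x : 𝔤) : rootProj H χ x ∈ rootSpace H χ :=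
  Submodule.projection_apply_mem _ x

end RootProjection

section PrincipalGrading

open LieAlgebra LieModule
open scoped Classical

variable {𝔤 : Type*} [LieRing 𝔤] [LieAlgebra ℂ 𝔤] [FiniteDimensional ℂ 𝔤]
  [LieAlgebra.IsSemisimple ℂ 𝔤]
  {H : LieSubalgebra ℂ 𝔤} [H.IsCartanSubalgebra]
  (Δ : (LieAlgebra.IsKilling.rootSystem H).Base)

/-- The element `∑ nᵢ αᵢ` of the root lattice. -/
def latticeWeight (n : Δ.support → ℤ) : Module.Dual ℂ H := ∑ i, n i • simpleRoot Δ i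

lemma simpleRoot_eq_basis (i : Δ.support) : simpleRoot Δ i = Δ.toWeightBasis i := by
  simp [simpleRoot]

lemma latticeWeight_add (n m : Δ.support → ℤ) :
    latticeWeight Δ (n + m) = latticeWeight Δ n + latticeWeight Δ m := by
  simp [latticeWeight, add_smul, Finset.sum_add_distrib]

lemma latticeWeight_zero : latticeWeight Δ 0 = 0 := by
  simp [latticeWeight]

lemma latticeWeight_single (i : Δ.support) :
    latticeWeight Δ (Pi.single i 1) = simpleRoot Δ i := by
  rw [latticeWeight, Finset.sum_eq_single i]
  · simp
  · intro j _ hj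
    simp [hj]
  · simp

lemma latticeWeight_neg (n : Δ.support → ℤ) : latticeWeight Δ (-n) = -latticeWeight Δ n := by
  simp [latticeWeight]

/-- The simple roots are linearly independent over `ℂ`, and `ℤ` embeds in `ℂ`. -/
lemma latticeWeight_injective : Function.Injective (latticeWeight Δ) := by
  intro n m h
  have h' : latticeWeight Δ (n - m) = 0 := by
    rw [sub_eq_add_neg, latticeWeight_add, latticeWeight_neg, h, add_neg_cancel]
  have hl := Δ.toWeightBasis.linearIndependent
  rw [Fintype.linearIndependent_iff] at hl
  have := hl (fun i => ((n - m) i : ℂ)) (by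
    rw [← h']
    refine Finset.sum_congr rfl fun i _ => ?_
    rw [simpleRoot_eq_basis, Int.cast_smul_eq_zsmul])
  funext i
  have h2 := this i
  simp only [Pi.sub_apply, Int.cast_eq_zero] at h2
  omega

lemma rootSpace_latticeWeight_le (n : Δ.support → ℤ) :
    (rootSpace H ⇑(latticeWeight Δ n)).toSubmodule ≤ gradedPiece Δ (∑ i, n i) :=
  le_iSup₂_of_le (f := fun (m : Δ.support → ℤ) (_ : ∑ i, m i = ∑ i, n i) =>
    (rootSpace H ⇑(∑ i, m i • simpleRoot Δ i)).toSubmodule) n rfl le_rfl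

lemma gradedPiece_induction {k : ℤ} {p : 𝔤 → Prop} (hzero : p 0)
    (hadd : ∀ x y, p x → p y → p (x + y))
    (hroot : ∀ n : Δ.support → ℤ, ∑ i, n i = k → ∀ x ∈ rootSpace H ⇑(latticeWeight Δ n), p x)
    {x : 𝔤} (hx : x ∈ gradedPiece Δ k) : p x := by
  rw [gradedPiece, iSup_subtype'] at hx
  exact Submodule.iSup_induction _ (motive := p) hx (fun i x hx => hroot i.1 i.2 x hx) hzero hadd

lemma gradedPiece_le_filtration {k r : ℤ} (h : k ≤ r) : gradedPiece Δ r ≤ filtration Δ k :=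
  le_iSup₂_of_le (f := fun (r : ℤ) (_ : k ≤ r) => gradedPiece Δ r) r h le_rfl

lemma filtration_induction {k : ℤ} {p : 𝔤 → Prop} (hzero : p 0)
    (hadd : ∀ x y, p x → p y → p (x + y))
    (hpiece : ∀ r, k ≤ r → ∀ x ∈ gradedPiece Δ r, p x)
    {x : 𝔤} (hx : x ∈ filtration Δ k) : p x := by
  rw [filtration, iSup_subtype'] at hx
  exact Submodule.iSup_induction _ (motive := p) hx (fun i x hx => hpiece i.1 i.2 x hx) hzero hadd

lemma filtration_antitone : Antitone (filtration Δ) := fun _ _ h =>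
  iSup₂_le fun _ hr => gradedPiece_le_filtration Δ (h.trans hr)

lemma filtration_eq_sup (k : ℤ) :
    filtration Δ k = gradedPiece Δ k ⊔ filtration Δ (k + 1) := by
  refine le_antisymm (iSup₂_le fun r hr => ?_)
    (sup_le (gradedPiece_le_filtration Δ le_rfl) (filtration_antitone Δ (by omega)))
  rcases hr.eq_or_lt with rfl | hr
  · exact le_sup_left
  · exact le_sup_of_le_right (gradedPiece_le_filtration Δ (by omega))

lemma lie_mem_gradedPiece {j k : ℤ} {x y : 𝔤} (hx : x ∈ gradedPiece Δ j)
    (hy : y ∈ gradedPiece Δ k) : ⁅x, y⁆ ∈ gradedPiece Δ (j + k) := by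
  refine gradedPiece_induction Δ (p := fun x => ⁅x, y⁆ ∈ gradedPiece Δ (j + k)) (by simp)
    (fun a b ha hb => by rw [add_lie]; exact add_mem ha hb) (fun n hn a ha => ?_) hx
  refine gradedPiece_induction Δ (p := fun y => ⁅a, y⁆ ∈ gradedPiece Δ (j + k)) (by simp)
    (fun c b hc hb => by rw [lie_add]; exact add_mem hc hb) (fun m hm b hb => ?_) hy
  have h := lie_mem_genWeightSpace_of_mem_genWeightSpace ha hb
  rw [show ⇑(latticeWeight Δ n) + ⇑(latticeWeight Δ m) = ⇑(latticeWeight Δ (n + m)) by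
    rw [latticeWeight_add]; rfl] at h
  have h2 := rootSpace_latticeWeight_le Δ (n + m) h
  rwa [Finset.sum_congr rfl fun i _ => Pi.add_apply n m i, Finset.sum_add_distrib, hn, hm] at h2

lemma lie_mem_filtration {j k : ℤ} {x y : 𝔤} (hx : x ∈ filtration Δ j)
    (hy : y ∈ filtration Δ k) : ⁅x, y⁆ ∈ filtration Δ (j + k) := by
  refine filtration_induction Δ (p := fun x => ⁅x, y⁆ ∈ filtration Δ (j + k)) (by simp)
    (fun a b ha hb => by rw [add_lie]; exact add_mem ha hb) (fun r hr a ha => ?_) hx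
  refine filtration_induction Δ (p := fun y => ⁅a, y⁆ ∈ filtration Δ (j + k)) (by simp)
    (fun c b hc hb => by rw [lie_add]; exact add_mem hc hb) (fun s hs b hb => ?_) hy
  exact gradedPiece_le_filtration Δ (by omega) (lie_mem_gradedPiece Δ ha hb)

/-- A nonzero element `∑ nᵢ αᵢ` of the root lattice with nonzero root space has coefficients of
the same sign. -/
lemma pos_or_neg_of_rootSpace_ne_bot {n : Δ.support → ℤ} (hn : n ≠ 0)
    (h : rootSpace H ⇑(latticeWeight Δ n) ≠ ⊥) : 0 ≤ n ∨ n ≤ 0 := by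
  let χ : Weight ℂ H 𝔤 := ⟨⇑(latticeWeight Δ n), h⟩
  have hχ : χ.IsNonZero := by
    intro h0
    apply hn
    apply latticeWeight_injective Δ
    rw [latticeWeight_zero]
    exact DFunLike.coe_injective h0
  let f : H.root → ℤ := fun i => if hi : i ∈ Δ.support then n ⟨i, hi⟩ else 0
  have hsum : ∑ j ∈ Δ.support, f j • (IsKilling.rootSystem H).root j = latticeWeight Δ n := by
    rw [latticeWeight, ← Finset.sum_coe_sort]
    refine Finset.sum_congr rfl fun i _ => ?_
    simp [f, simpleRoot]
  have key := Δ.pos_or_neg_of_sum_smul_root_mem f (by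
      rw [hsum]
      refine ⟨⟨χ, by simpa using hχ⟩, ?_⟩
      ext x
      rfl) (by
      intro i hi
      by_contra hcon
      exact hi (by simp [f, show i ∉ Δ.support from hcon]))
  refine key.imp (fun h i => ?_) (fun h i => ?_)
  · have := h.le i.1
    simpa [f] using this
  · have := h.le i.1
    simpa [f] using this

/-- The coefficients of a root have one sign, so they cannot sum to zero; only the weight `0`
contributes in degree `0`. -/
lemma gradedPiece_zero : gradedPiece Δ 0 = H.toSubmodule := by
  refine le_antisymm (fun x hx => ?_) fun x hx => ?_
  · refine gradedPiece_induction Δ (zero_mem _) (fun _ _ => add_mem) (fun n hn x hx => ?_) hx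
    by_cases h0 : n = 0
    · subst h0
      rw [latticeWeight_zero] at hx
      rw [← rootSpace_zero_toSubmodule]
      exact hx
    by_cases hb : rootSpace H ⇑(latticeWeight Δ n) = ⊥
    · rw [hb] at hx
      rw [(LieSubmodule.mem_bot x).mp hx]
      exact zero_mem _
    exfalso
    apply h0
    funext i
    rcases pos_or_neg_of_rootSpace_ne_bot Δ h0 hb with h | h
    · exact (Finset.sum_eq_zero_iff_of_nonneg fun i _ => h i).mp hn i (Finset.mem_univ i)
    · exact (Finset.sum_eq_zero_iff_of_nonpos fun i _ => h i).mp hn i (Finset.mem_univ i)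
  · rw [← rootSpace_zero_toSubmodule] at hx
    have := rootSpace_latticeWeight_le Δ 0
    rw [latticeWeight_zero] at this
    simpa using this hx

lemma rootSpace_simpleRoot_le (i : Δ.support) :
    (rootSpace H ⇑(simpleRoot Δ i)).toSubmodule ≤ gradedPiece Δ 1 := by
  have := rootSpace_latticeWeight_le Δ (Pi.single i 1)
  rw [latticeWeight_single] at this
  simpa using this

lemma rootSpace_neg_simpleRoot_le (i : Δ.support) :
    (rootSpace H ⇑(-simpleRoot Δ i)).toSubmodule ≤ gradedPiece Δ (-1) := by
  have := rootSpace_latticeWeight_le Δ (-Pi.single i 1)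
  rw [latticeWeight_neg, latticeWeight_single] at this
  simpa using this

lemma rootProj_neg_simpleRoot_of_mem_filtration (i : Δ.support) {x : 𝔤}
    (hx : x ∈ filtration Δ 0) : rootProj H ⇑(-simpleRoot Δ i) x = 0 := by
  refine filtration_induction Δ (p := fun x => rootProj H ⇑(-simpleRoot Δ i) x = 0) (by simp)
    (fun a b ha hb => by rw [map_add, ha, hb, add_zero]) (fun r hr a ha => ?_) hx
  refine gradedPiece_induction Δ (p := fun x => rootProj H ⇑(-simpleRoot Δ i) x = 0) (by simp)
    (fun a b ha hb => by rw [map_add, ha, hb, add_zero]) (fun n hn a ha => ?_) ha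
  refine rootProj_apply_of_ne (fun h => ?_) ha
  have h2 := DFunLike.coe_injective h
  rw [← latticeWeight_single, ← latticeWeight_neg] at h2
  rw [latticeWeight_injective Δ h2] at hn
  simp at hn
  omega

/-- A root of height `-1` has nonpositive integer coefficients with sum `-1`, so it is the negative
of a simple root. -/
lemma eq_sum_rootProj_of_mem_gradedPiece {x : 𝔤} (hx : x ∈ gradedPiece Δ (-1)) :
    x = ∑ i, rootProj H ⇑(-simpleRoot Δ i) x := by
  refine gradedPiece_induction Δ (p := fun x => x = ∑ i, rootProj H ⇑(-simpleRoot Δ i) x) (by simp)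
    (fun a b ha hb => by
      simp only [map_add, Finset.sum_add_distrib]
      rw [← ha, ← hb]) (fun n hn x hx => ?_) hx
  by_cases hb : rootSpace H ⇑(latticeWeight Δ n) = ⊥
  · rw [hb] at hx
    rw [(LieSubmodule.mem_bot x).mp hx]
    simp
  have h0 : n ≠ 0 := by
    rintro rfl
    simp at hn
  have hneg : n ≤ 0 := by
    rcases pos_or_neg_of_rootSpace_ne_bot Δ h0 hb with h | h
    · have := Finset.sum_nonneg fun i (_ : i ∈ Finset.univ) => h i
      omega
    · exact h
  obtain ⟨i, hi⟩ : ∃ i, n i ≠ 0 := by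
    by_contra! h
    exact h0 (funext h)
  have hni : n = -Pi.single i 1 := by
    have hsplit := Finset.add_sum_erase Finset.univ n (Finset.mem_univ i)
    have hle : ∑ j ∈ Finset.univ.erase i, n j ≤ 0 := Finset.sum_nonpos fun j _ => hneg j
    have hi' : n i ≤ -1 := by
      have : n i ≤ 0 := hneg i
      omega
    have hz : ∑ j ∈ Finset.univ.erase i, n j = 0 := by omega
    rw [Finset.sum_eq_zero_iff_of_nonpos fun j _ => hneg j] at hz
    funext j
    by_cases hj : j = i
    · subst hj
      simp
      omega
    · rw [hz j (by simp [hj])]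
      simp [hj]
  rw [hni, latticeWeight_neg, latticeWeight_single] at hx
  rw [Finset.sum_eq_single i, rootProj_apply_of_mem hx]
  · intro j _ hj
    refine rootProj_apply_of_ne (fun h => hj ?_) hx
    have h2 := DFunLike.coe_injective h
    rw [simpleRoot_eq_basis, simpleRoot_eq_basis, neg_inj] at h2
    exact (Δ.toWeightBasis.injective h2).symm
  · simp

lemma sub_sum_rootProj_mem_filtration {x : 𝔤} (hx : x ∈ filtration Δ (-1)) :
    x - ∑ i, rootProj H ⇑(-simpleRoot Δ i) x ∈ filtration Δ 0 := by
  rw [filtration_eq_sup, Submodule.mem_sup] at hx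
  obtain ⟨y, hy, z, hz, rfl⟩ := hx
  simp only [map_add, Finset.sum_add_distrib]
  rw [← eq_sum_rootProj_of_mem_gradedPiece Δ hy, Finset.sum_eq_zero
    fun i _ => rootProj_neg_simpleRoot_of_mem_filtration Δ i hz]
  simpa using hz

/-- The fundamental coweights: the basis of `𝔥` dual to the simple roots. -/
def coweight (i : Δ.support) : H := by
  classical exact (Module.evalEquiv ℂ H).symm (Δ.toWeightBasis.dualBasis i)

lemma simpleRoot_coweight (i j : Δ.support) :
    simpleRoot Δ i (coweight Δ j) = if i = j then 1 else 0 := by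
  rw [simpleRoot_eq_basis, coweight, Module.apply_evalEquiv_symm_apply,
    Module.Basis.dualBasis_apply, Module.Basis.repr_self, Finsupp.single_apply]

/-- Both sides agree under every simple root; these form a basis of `𝔥*`, and linear forms separate
points. -/
lemma eq_sum_coweight (h : H) : h = ∑ i, simpleRoot Δ i h • coweight Δ i := by
  have key : ∀ l : Module.Dual ℂ H, l h = l (∑ i, simpleRoot Δ i h • coweight Δ i) := by
    intro l
    have : LinearMap.applyₗ (R := ℂ) h =
        LinearMap.applyₗ (M₂ := ℂ) (∑ i, simpleRoot Δ i h • coweight Δ i) := by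
      refine Δ.toWeightBasis.ext fun j => ?_
      rw [← simpleRoot_eq_basis]
      simp [simpleRoot_coweight]
    exact congrArg (fun f => f l) this
  refine sub_eq_zero.mp ((Module.forall_dual_apply_eq_zero_iff ℂ _).mp fun l => ?_)
  rw [map_sub, ← key, sub_self]

/-- The element `ρ^∨` of `𝔥` that defines the principal grading. -/
def gradingElement : H := ∑ i, coweight Δ i

lemma simpleRoot_gradingElement (i : Δ.support) : simpleRoot Δ i (gradingElement Δ) = 1 := by
  simp [gradingElement, simpleRoot_coweight]

lemma latticeWeight_gradingElement (n : Δ.support → ℤ) :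
    latticeWeight Δ n (gradingElement Δ) = (∑ i, n i : ℤ) := by
  simp [latticeWeight, simpleRoot_gradingElement]

/-- By semisimplicity the generalized root spaces are true eigenspaces, and `ρ^∨` pairs with a
weight to give its height. Degrees can therefore be tested by `ad ρ^∨`. -/
lemma lie_gradingElement {k : ℤ} {x : 𝔤} (hx : x ∈ gradedPiece Δ k) :
    ⁅(gradingElement Δ : 𝔤), x⁆ = (k : ℂ) • x := by
  refine gradedPiece_induction Δ (p := fun x => ⁅(gradingElement Δ : 𝔤), x⁆ = (k : ℂ) • x)
    (by simp) (fun a b ha hb => by rw [lie_add, ha, hb, smul_add]) (fun n hn x hx => ?_) hx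
  have := IsKilling.lie_eq_smul_of_mem_rootSpace hx (gradingElement Δ)
  rw [latticeWeight_gradingElement, hn] at this
  exact this

lemma mem_gradedPiece_of_gradingElement : (gradingElement Δ : 𝔤) ∈ gradedPiece Δ 0 := by
  rw [gradedPiece_zero]
  exact (gradingElement Δ).2

/-- Each nonzero piece makes its degree an eigenvalue of `ad ρ^∨`, which has finitely many. -/
lemma exists_gradedPiece_eq_bot : ∃ N : ℤ, 0 ≤ N ∧ ∀ k, N < |k| → gradedPiece Δ k = ⊥ := by
  have hfin := Module.End.finite_hasEigenvalue (LieAlgebra.ad ℂ 𝔤 (gradingElement Δ : 𝔤))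
  have hfin2 : {k : ℤ | gradedPiece Δ k ≠ ⊥}.Finite := by
    refine (hfin.preimage (f := fun k : ℤ => (k : ℂ)) Int.cast_injective.injOn).subset ?_
    intro k hk
    obtain ⟨x, hx, hx0⟩ := Submodule.exists_mem_ne_zero_of_ne_bot hk
    exact Module.End.hasEigenvalue_of_hasEigenvector
      ⟨Module.End.mem_eigenspace_iff.mpr (lie_gradingElement Δ hx), hx0⟩
  obtain ⟨N, hN⟩ := (hfin2.image (fun k => |k|)).bddAbove
  refine ⟨max N 0, le_max_right _ _, fun k hk => ?_⟩
  by_contra hcon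
  have := hN ⟨k, hcon, rfl⟩
  simp only at this
  omega

lemma exists_filtration_eq_bot : ∃ N : ℤ, 0 ≤ N ∧ ∀ k, N < k → filtration Δ k = ⊥ := by
  obtain ⟨N, hN0, hN⟩ := exists_gradedPiece_eq_bot Δ
  refine ⟨N, hN0, fun k hk => eq_bot_iff.mpr (iSup₂_le fun r hr => ?_)⟩
  rw [hN r (lt_of_lt_of_le (hk.trans_le hr) (le_abs_self r))]

/-- The root spaces span `𝔤`, and every root is an integral combination of simple roots. -/
lemma iSup_gradedPiece : ⨆ k, gradedPiece Δ k = ⊤ := by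
  have ht := congrArg LieSubmodule.toSubmodule (iSup_genWeightSpace_eq_top' ℂ H 𝔤)
  rw [LieSubmodule.iSup_toSubmodule, LieSubmodule.top_toSubmodule] at ht
  rw [eq_top_iff, ← ht]
  refine iSup_le fun χ => ?_
  obtain ⟨n, hn⟩ : ∃ n : Δ.support → ℤ, (χ : H → ℂ) = ⇑(latticeWeight Δ n) := by
    by_cases h0 : χ.IsZero
    · refine ⟨0, ?_⟩
      rw [latticeWeight_zero]
      exact h0
    · obtain ⟨f, -, -, hf⟩ := Δ.exists_root_eq_sum_int ⟨χ, by simpa using h0⟩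
      refine ⟨fun i => f i, ?_⟩
      have : χ.toLinear = latticeWeight Δ (fun i => f i) := by
        rw [latticeWeight]
        refine Eq.trans hf ?_
        rw [← Finset.sum_coe_sort]
        rfl
      rw [← this]
      rfl
  rw [hn]
  exact (rootSpace_latticeWeight_le Δ n).trans (le_iSup _ _)

lemma exists_filtration_eq_top : ∃ N : ℤ, 0 ≤ N ∧ filtration Δ (-N) = ⊤ := by
  obtain ⟨N, hN0, hN⟩ := exists_gradedPiece_eq_bot Δ
  refine ⟨N, hN0, ?_⟩
  rw [eq_top_iff, ← iSup_gradedPiece Δ]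
  refine iSup_le fun k => ?_
  by_cases hk : N < |k|
  · rw [hN k hk]
    exact bot_le
  · exact gradedPiece_le_filtration Δ (by have := neg_abs_le k; omega)

/-- Generators `eᵢ ∈ 𝔤^{αᵢ}` and `fᵢ ∈ 𝔤^{-αᵢ}` with `[eᵢ, fⱼ] = δᵢⱼ αᵢ^∨`. -/
structure ChevalleyGenerators where
  /-- The generator of `𝔤^{αᵢ}`. -/
  e : Δ.support → 𝔤
  /-- The generator of `𝔤^{-αᵢ}`. -/
  f : Δ.support → 𝔤
  e_mem : ∀ i, e i ∈ rootSpace H ⇑(simpleRoot Δ i)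
  f_mem : ∀ i, f i ∈ rootSpace H ⇑(-simpleRoot Δ i)
  e_ne_zero : ∀ i, e i ≠ 0
  f_ne_zero : ∀ i, f i ≠ 0
  rootSpace_neg_eq_span :
    ∀ i, (rootSpace H ⇑(-simpleRoot Δ i)).toSubmodule = Submodule.span ℂ {f i}
  lie_e_f : ∀ i, ⁅e i, f i⁆ = (Δ.toCoweightBasis i : H)
  lie_e_f_of_ne : ∀ i j, i ≠ j → ⁅e i, f j⁆ = 0

/-- Each simple root has an `𝔰𝔩₂`-triple with `h` its coroot, and its root spaces are lines. For `i
≠ j` the bracket `[eᵢ, fⱼ]` has weight `αᵢ - αⱼ`, which is nonzero with coefficients of both signs,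
hence is not a root. -/
lemma nonempty_chevalleyGenerators : Nonempty (ChevalleyGenerators Δ) := by
  have hnz : ∀ i : Δ.support, (i.1.1 : Weight ℂ H 𝔤).IsNonZero := fun i =>
    LieSubalgebra.isNonZero_coe_root i.1
  choose h e f ht he hf using fun i : Δ.support =>
    IsKilling.exists_isSl2Triple_of_weight_isNonZero (hnz i)
  have hcoe : ∀ i : Δ.support, ⇑(-simpleRoot Δ i) = -⇑(i.1.1 : Weight ℂ H 𝔤) := fun i => rfl
  have hfin : ∀ i, (rootSpace H ⇑(-simpleRoot Δ i)).toSubmodule = Submodule.span ℂ {f i} := by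
    intro i
    have h1 := IsKilling.finrank_rootSpace_eq_one (-(i.1.1 : Weight ℂ H 𝔤)) (hnz i).neg
    rw [Weight.coe_neg, ← hcoe] at h1
    symm
    refine Submodule.eq_of_le_of_finrank_eq ?_ ?_
    · rw [Submodule.span_singleton_le_iff_mem, hcoe]
      exact hf i
    · rw [finrank_span_singleton (ht i).f_ne_zero]
      exact h1.symm
  refine ⟨⟨e, f, he, fun i => hf i, fun i => (ht i).e_ne_zero, fun i => (ht i).f_ne_zero, hfin,
    fun i => ?_, fun i j hij => ?_⟩⟩
  · rw [(ht i).lie_e_f, (ht i).h_eq_coroot (hnz i) (he i) (hf i)]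
    simp
  · have h1 := lie_mem_genWeightSpace_of_mem_genWeightSpace (he i) (hf j)
    have h2 : (⇑(i.1.1 : Weight ℂ H 𝔤) + -⇑(j.1.1 : Weight ℂ H 𝔤)) =
        ⇑(latticeWeight Δ (Pi.single i 1 + -Pi.single j 1)) := by
      rw [latticeWeight_add, latticeWeight_neg, latticeWeight_single, latticeWeight_single]
      rfl
    rw [h2] at h1
    by_contra hne
    have hb : rootSpace H ⇑(latticeWeight Δ (Pi.single i 1 + -Pi.single j 1)) ≠ ⊥ := by
      intro hb
      exact hne ((LieSubmodule.mem_bot _).mp (hb.le h1))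
    have h0 : (Pi.single i 1 + -Pi.single j 1 : Δ.support → ℤ) ≠ 0 := by
      intro h0
      have := congrFun h0 i
      simp [hij] at this
    rcases pos_or_neg_of_rootSpace_ne_bot Δ h0 hb with h | h
    · have := h j
      simp [Ne.symm hij] at this
    · have := h i
      simp [hij] at this

end PrincipalGrading

/-! ### Inner automorphisms and the Borel subgroup -/

section InnerAutomorphisms

variable {𝔤 : Type*} [LieRing 𝔤] [LieAlgebra ℂ 𝔤]

lemma IsExpAd.map_lie {x : 𝔤} {σ : LinearMap.GeneralLinearGroup ℂ 𝔤} (h : IsExpAd x σ)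
    (y z : 𝔤) : σ.1 ⁅y, z⁆ = ⁅σ.1 y, σ.1 z⁆ := by
  obtain ⟨k, hk, hσ⟩ := h
  -- The exponential of a nilpotent derivation is a Lie automorphism; that theory is phrased over
  -- `ℚ`, so the scalars are restricted.
  let _ : Module ℚ 𝔤 := Module.compHom 𝔤 (algebraMap ℚ ℂ)
  let _ : LieAlgebra ℚ 𝔤 := { lie_smul := fun t x y => lie_smul (algebraMap ℚ ℂ t) x y }
  have had : (LieDerivation.ad ℂ 𝔤 x).toLinearMap = LieAlgebra.ad ℂ 𝔤 x := by
    ext y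
    simp
  have hnil : IsNilpotent (LieDerivation.ad ℂ 𝔤 x).toLinearMap := ⟨k, had ▸ hk⟩
  have hexp : σ.1 = IsNilpotent.exp (LieDerivation.ad ℂ 𝔤 x).toLinearMap := by
    rw [had, IsNilpotent.exp_eq_sum hk, hσ]
    refine Finset.sum_congr rfl fun n _ => ?_
    ext v
    change (n.factorial : ℂ)⁻¹ • (LieAlgebra.ad ℂ 𝔤 x ^ n) v =
      algebraMap ℚ ℂ (n.factorial : ℚ)⁻¹ • (LieAlgebra.ad ℂ 𝔤 x ^ n) v
    rw [map_inv₀, map_natCast]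
  have := (LieDerivation.exp (LieDerivation.ad ℂ 𝔤 x) hnil).map_lie y z
  simp only [LieDerivation.exp_map_apply] at this
  rw [hexp]
  exact this

lemma map_lie_of_mem_adjointGroup {σ : LinearMap.GeneralLinearGroup ℂ 𝔤}
    (h : σ ∈ adjointGroup 𝔤) (y z : 𝔤) : σ.1 ⁅y, z⁆ = ⁅σ.1 y, σ.1 z⁆ := by
  induction h using Subgroup.closure_induction generalizing y z with
  | mem σ h =>
    obtain ⟨x, hx⟩ := h
    exact hx.map_lie y z
  | one => simp
  | mul σ τ _ _ hσ hτ => simp only [Units.val_mul, Module.End.mul_apply, hσ, hτ]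
  | inv σ _ hσ =>
    have hinv : ∀ v, σ.1 (σ⁻¹.1 v) = v := fun v => by
      rw [← Module.End.mul_apply, ← Units.val_mul, mul_inv_cancel, Units.val_one,
        Module.End.one_apply]
    have hinv' : ∀ v, σ⁻¹.1 (σ.1 v) = v := fun v => by
      rw [← Module.End.mul_apply, ← Units.val_mul, inv_mul_cancel, Units.val_one,
        Module.End.one_apply]
    rw [← hinv' ⁅σ⁻¹.1 y, σ⁻¹.1 z⁆, hσ, hinv, hinv]

end InnerAutomorphisms

/-! ### The Borel subgroup and the principal filtration -/

section Borel

open LieAlgebra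

variable {𝔤 : Type*} [LieRing 𝔤] [LieAlgebra ℂ 𝔤] [FiniteDimensional ℂ 𝔤]

/-- The stabilizer of a subspace in `GL(𝔤)`. -/
def stabilizer (W : Submodule ℂ 𝔤) : Subgroup (LinearMap.GeneralLinearGroup ℂ 𝔤) where
  carrier := {σ | ∀ x ∈ W, σ.1 x ∈ W}
  one_mem' := fun x hx => hx
  mul_mem' := fun hσ hτ x hx => hσ _ (hτ x hx)
  -- Only `σ W ⊆ W` is assumed; finite dimension turns the injective restriction into a bijection of
  -- `W`.
  inv_mem' := fun {σ} hσ x hx => by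
    have hinj : Function.Injective (σ.1.restrict hσ) := by
      intro a b hab
      have h := congrArg (fun v : W => σ⁻¹.1 v.1) hab
      simp only [LinearMap.coe_restrict_apply, ← Module.End.mul_apply, ← Units.val_mul,
        inv_mul_cancel, Units.val_one, Module.End.one_apply] at h
      exact Subtype.ext h
    obtain ⟨y, hy⟩ := LinearMap.injective_iff_surjective.mp hinj ⟨x, hx⟩
    have h := congrArg (fun v : W => σ⁻¹.1 v.1) hy
    simp only [LinearMap.coe_restrict_apply, ← Module.End.mul_apply, ← Units.val_mul,
      inv_mul_cancel, Units.val_one, Module.End.one_apply] at h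
    rw [← h]
    exact y.2

variable [LieAlgebra.IsSemisimple ℂ 𝔤]
  {H : LieSubalgebra ℂ 𝔤} [H.IsCartanSubalgebra]
  (Δ : (LieAlgebra.IsKilling.rootSystem H).Base)

/-- A Lie automorphism that fixes `𝔥` pointwise commutes with `ad 𝔥`. -/
lemma mem_rootSpace_of_mem_cartanSubgroup {σ : LinearMap.GeneralLinearGroup ℂ 𝔤}
    (hσ : σ ∈ cartanSubgroup H) {χ : H → ℂ} {x : 𝔤} (hx : x ∈ rootSpace H χ) :
    σ.1 x ∈ rootSpace H χ := by
  refine (LieModule.mem_genWeightSpace _ _ _).mpr fun h => ⟨1, ?_⟩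
  have h1 : ⁅(h : 𝔤), x⁆ = χ h • x := IsKilling.lie_eq_smul_of_mem_rootSpace hx h
  have h2 := congrArg σ.1 h1
  rw [map_lie_of_mem_adjointGroup hσ.1, hσ.2 h h.2, map_smul] at h2
  rw [pow_one, LinearMap.sub_apply, LieModule.toEnd_apply_apply, LinearMap.smul_apply,
    Module.End.one_apply, sub_eq_zero]
  exact h2

lemma mem_filtration_of_mem_cartanSubgroup {σ : LinearMap.GeneralLinearGroup ℂ 𝔤}
    (hσ : σ ∈ cartanSubgroup H) {k : ℤ} {x : 𝔤} (hx : x ∈ filtration Δ k) :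
    σ.1 x ∈ filtration Δ k := by
  refine filtration_induction Δ (p := fun x => σ.1 x ∈ filtration Δ k) (by simp)
    (fun a b ha hb => by rw [map_add]; exact add_mem ha hb) (fun r hr x hx => ?_) hx
  refine gradedPiece_induction Δ (p := fun x => σ.1 x ∈ filtration Δ k) (by simp)
    (fun a b ha hb => by rw [map_add]; exact add_mem ha hb) (fun n hn x hx => ?_) hx
  refine gradedPiece_le_filtration Δ hr ?_
  rw [← hn]
  exact rootSpace_latticeWeight_le Δ n (mem_rootSpace_of_mem_cartanSubgroup hσ hx)

lemma IsExpAd.sub_mem_filtration {x : 𝔤} (hx : x ∈ filtration Δ 1)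
    {σ : LinearMap.GeneralLinearGroup ℂ 𝔤} (h : IsExpAd x σ) {k : ℤ} {y : 𝔤}
    (hy : y ∈ filtration Δ k) : σ.1 y - y ∈ filtration Δ (k + 1) := by
  obtain ⟨N, hN, hσ⟩ := h
  have hpow : ∀ n : ℕ, (ad ℂ 𝔤 x ^ n) y ∈ filtration Δ (k + n) := by
    intro n
    induction n with
    | zero => simpa using hy
    | succ n ih =>
      rw [pow_succ', Module.End.mul_apply, ad_apply]
      have := lie_mem_filtration Δ hx ih
      rwa [show (1 : ℤ) + (k + n) = k + (n + 1 : ℕ) by push_cast; ring] at this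
  -- For `N = 0` the hypothesis `(ad x)^0 = 0` forces `𝔤 = 0`. Otherwise `σ y - y` consists of the
  -- terms of positive order of the exponential, each raising the degree.
  rcases N with _ | N
  · have hy0 : y = 0 := by
      have := congrArg (fun f => f y) hN
      simpa using this
    simp [hy0]
  · rw [hσ, Finset.sum_range_succ', LinearMap.add_apply, LinearMap.sum_apply]
    simp only [pow_zero, Nat.factorial_zero, Nat.cast_one, inv_one, one_smul,
      Module.End.one_apply, add_sub_cancel_right, LinearMap.smul_apply]
    refine sum_mem fun n _ => Submodule.smul_mem _ _ ?_
    exact filtration_antitone Δ (by push_cast; omega) (hpow (n + 1))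

/-- The unipotent generators act trivially on `𝔤^k / 𝔤^{k+1}`, so a subspace between `𝔤^{k+1}` and
`𝔤^k` only has to be stable under the Cartan subgroup. The cases needed are `V = 0` and `V =
𝔤^{-α}`. -/
lemma borelSubgroup_le_stabilizer_of_le {k : ℤ} {V : Submodule ℂ 𝔤}
    (hV : ∀ σ ∈ cartanSubgroup H, ∀ x ∈ V, σ.1 x ∈ V) (hVk : V ≤ filtration Δ k) :
    borelSubgroup Δ ≤ stabilizer (V ⊔ filtration Δ (k + 1)) := by
  refine sup_le (fun σ hσ x hx => ?_) ((Subgroup.closure_le _).mpr ?_)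
  · obtain ⟨a, ha, b, hb, rfl⟩ := Submodule.mem_sup.mp hx
    rw [map_add]
    exact add_mem (Submodule.mem_sup_left (hV σ hσ a ha))
      (Submodule.mem_sup_right (mem_filtration_of_mem_cartanSubgroup Δ hσ hb))
  · rintro σ ⟨n, hn, hσ⟩ x hx
    have hx' : x ∈ filtration Δ k := sup_le hVk (filtration_antitone Δ (by omega)) hx
    rw [← sub_add_cancel (σ.1 x) x]
    exact add_mem (Submodule.mem_sup_right (hσ.sub_mem_filtration Δ hn hx')) hx

lemma mem_filtration_of_mem_borelSubgroup {σ : LinearMap.GeneralLinearGroup ℂ 𝔤}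
    (hσ : σ ∈ borelSubgroup Δ) {k : ℤ} {x : 𝔤} (hx : x ∈ filtration Δ k) :
    σ.1 x ∈ filtration Δ k := by
  have := borelSubgroup_le_stabilizer_of_le Δ (k := k - 1) (V := ⊥) (by simp) bot_le hσ
  rw [sub_add_cancel, bot_sup_eq] at this
  exact this x hx

lemma map_neg_simpleRoot_of_mem_borelSubgroup {σ : LinearMap.GeneralLinearGroup ℂ 𝔤}
    (hσ : σ ∈ borelSubgroup Δ) (i : Δ.support) {x : 𝔤}
    (hx : x ∈ rootSpace H ⇑(-simpleRoot Δ i)) :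
    σ.1 x ∈ (rootSpace H ⇑(-simpleRoot Δ i)).toSubmodule ⊔ filtration Δ 0 :=
  borelSubgroup_le_stabilizer_of_le Δ (k := -1)
    (V := (rootSpace H ⇑(-simpleRoot Δ i)).toSubmodule)
    (fun _ hσ _ hx => mem_rootSpace_of_mem_cartanSubgroup hσ hx)
    ((rootSpace_neg_simpleRoot_le Δ i).trans (gradedPiece_le_filtration Δ le_rfl)) hσ x
    (Submodule.mem_sup_left hx)

lemma map_sub_self_mem_of_mem_borelSubgroup {σ : LinearMap.GeneralLinearGroup ℂ 𝔤}
    (hσ : σ ∈ borelSubgroup Δ) {h : 𝔤} (hh : h ∈ H) : σ.1 h - h ∈ filtration Δ 1 := by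
  have hh0 : h ∈ filtration Δ 0 := by
    refine gradedPiece_le_filtration Δ le_rfl ?_
    rw [gradedPiece_zero]
    exact hh
  -- Membership in `B` is built into the carrier because closure under products and inverses needs
  -- `σ` to preserve `𝔤^1`.
  let T : Subgroup (LinearMap.GeneralLinearGroup ℂ 𝔤) :=
    { carrier := {σ | σ ∈ borelSubgroup Δ ∧ σ.1 h - h ∈ filtration Δ 1}
      one_mem' := ⟨one_mem _, by simp⟩
      mul_mem' := fun {σ τ} hσ hτ => ⟨mul_mem hσ.1 hτ.1, by
        have := mem_filtration_of_mem_borelSubgroup Δ hσ.1 hτ.2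
        rw [map_sub] at this
        rw [Units.val_mul, Module.End.mul_apply, ← sub_add_sub_cancel _ (σ.1 h) h]
        exact add_mem this hσ.2⟩
      inv_mem' := fun {σ} hσ => ⟨inv_mem hσ.1, by
        have := mem_filtration_of_mem_borelSubgroup Δ (inv_mem hσ.1) hσ.2
        rw [map_sub, ← Module.End.mul_apply, ← Units.val_mul, inv_mul_cancel, Units.val_one,
          Module.End.one_apply] at this
        rw [← neg_sub]
        exact neg_mem this⟩ }
  have hle : borelSubgroup Δ ≤ T := by
    refine sup_le (fun σ hσ => ⟨le_sup_left (a := cartanSubgroup H) hσ, ?_⟩)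
      ((Subgroup.closure_le _).mpr ?_)
    · rw [hσ.2 h hh, sub_self]
      exact zero_mem _
    · rintro σ ⟨n, hn, hσ⟩
      have h1 := hσ.sub_mem_filtration Δ hn hh0
      rw [zero_add] at h1
      exact ⟨le_sup_right (a := cartanSubgroup H) (Subgroup.subset_closure ⟨n, hn, hσ⟩), h1⟩
  exact (hle hσ).2

end Borel

/-! ### Points with values in a `ℂ`-algebra -/

section RPoints

variable {𝔤 : Type*} [AddCommGroup 𝔤] [Module ℂ 𝔤]
variable {R : Type*} [CommRing R] [Algebra ℂ R]

lemma baseChange_induction {W : Submodule ℂ 𝔤} {p : R ⊗[ℂ] 𝔤 → Prop} (hzero : p 0)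
    (hadd : ∀ x y, p x → p y → p (x + y)) (htmul : ∀ (r : R), ∀ x ∈ W, p (r ⊗ₜ x))
    {y : R ⊗[ℂ] 𝔤} (hy : y ∈ W.baseChange R) : p y := by
  rw [Submodule.baseChange_eq_span] at hy
  -- The span is taken over `R` while `p` is only additive, so all multiples are treated at once.
  have h : ∀ r : R, p (r • y) := by
    induction hy using Submodule.span_induction with
    | mem y hy =>
      obtain ⟨x, hx, rfl⟩ := hy
      intro r
      simpa [TensorProduct.smul_tmul'] using htmul r x hx
    | zero => simpa using hzero
    | add y z _ _ hy hz =>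
      intro r
      rw [smul_add]
      exact hadd _ _ (hy r) (hz r)
    | smul s y _ hy =>
      intro r
      rw [smul_smul]
      exact hy _
  simpa using h 1

lemma map_baseChange_mem {V W : Submodule ℂ 𝔤} (g : R ⊗[ℂ] 𝔤 →ₗ[ℂ] R ⊗[ℂ] 𝔤)
    (h : ∀ (r : R), ∀ x ∈ V, g (r ⊗ₜ x) ∈ W.baseChange R) {y : R ⊗[ℂ] 𝔤}
    (hy : y ∈ V.baseChange R) : g y ∈ W.baseChange R :=
  baseChange_induction (p := fun y => g y ∈ W.baseChange R) (by simp)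
    (fun a b ha hb => by rw [map_add]; exact add_mem ha hb) h hy

/-- An `R`-linear map sends `V ⊗ R` to `W ⊗ R` as soon as it does so on `V`. -/
lemma map_baseChange_mem_of_one_tmul {V W : Submodule ℂ 𝔤} (g : R ⊗[ℂ] 𝔤 →ₗ[R] R ⊗[ℂ] 𝔤)
    (h : ∀ x ∈ V, g (1 ⊗ₜ x) ∈ W.baseChange R) {y : R ⊗[ℂ] 𝔤}
    (hy : y ∈ V.baseChange R) : g y ∈ W.baseChange R := by
  refine map_baseChange_mem (g.restrictScalars ℂ) (fun r x hx => ?_) hy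
  have : (r ⊗ₜ[ℂ] x : R ⊗[ℂ] 𝔤) = r • ((1 : R) ⊗ₜ[ℂ] x) := by simp [TensorProduct.smul_tmul']
  rw [this, LinearMap.coe_restrictScalars, map_smul]
  exact Submodule.smul_mem _ _ (h x hx)

lemma dualExt_baseChange (l : Module.Dual ℂ 𝔤) (f : 𝔤 →ₗ[ℂ] 𝔤) (y : R ⊗[ℂ] 𝔤) :
    dualExt R l (f.baseChange R y) = dualExt R (l ∘ₗ f) y := by
  induction y with
  | zero => simp
  | tmul a x => simp
  | add y z hy hz => simp only [map_add, hy, hz]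

lemma baseChange_apply_mem {W : Submodule ℂ 𝔤} {f : 𝔤 →ₗ[ℂ] 𝔤} (hf : ∀ x, f x ∈ W)
    (y : R ⊗[ℂ] 𝔤) : f.baseChange R y ∈ W.baseChange R := by
  induction y with
  | zero => simp
  | tmul a x =>
    rw [LinearMap.baseChange_tmul]
    exact Submodule.tmul_mem_baseChange_of_mem a (hf x)
  | add y z hy hz =>
    rw [map_add]
    exact add_mem hy hz

lemma extMap_baseChange {R' : Type*} [CommRing R'] [Algebra ℂ R'] (ρ : R →ₐ[ℂ] R')
    (f : 𝔤 →ₗ[ℂ] 𝔤) (y : R ⊗[ℂ] 𝔤) :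
    extMap 𝔤 ρ (f.baseChange R y) = f.baseChange R' (extMap 𝔤 ρ y) := by
  induction y with
  | zero => simp
  | tmul a x => simp
  | add y z hy hz => simp only [map_add, hy, hz]

lemma extMap_mem_baseChange {R' : Type*} [CommRing R'] [Algebra ℂ R'] (ρ : R →ₐ[ℂ] R')
    {W : Submodule ℂ 𝔤} {x : R ⊗[ℂ] 𝔤} (hx : x ∈ W.baseChange R) :
    extMap 𝔤 ρ x ∈ W.baseChange R' :=
  baseChange_induction (p := fun x => extMap 𝔤 ρ x ∈ W.baseChange R') (by simp)
    (fun a b ha hb => by rw [map_add]; exact add_mem ha hb)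
    (fun r x hx => by
      rw [extMap_tmul]
      exact Submodule.tmul_mem_baseChange_of_mem _ hx) hx

/-- A linear form not vanishing at `x` takes there a value that is a unit in `R`. -/
lemma one_tmul_smul_eq_zero {x : 𝔤} (hx : x ≠ 0) {r : R}
    (h : r • ((1 : R) ⊗ₜ[ℂ] x) = 0) : r = 0 := by
  have hlx : ∃ l : Module.Dual ℂ 𝔤, l x ≠ 0 := by
    by_contra! hcon
    exact hx ((Module.forall_dual_apply_eq_zero_iff ℂ x).mp hcon)
  obtain ⟨l, hl⟩ := hlx
  have h2 := congrArg (dualExt R l) h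
  rw [map_smul, dualExt_tmul, map_zero, one_mul, smul_eq_mul] at h2
  have hu : IsUnit (algebraMap ℂ R (l x)) := (IsUnit.mk0 _ hl).map _
  exact hu.mul_left_eq_zero.mp h2

variable [FiniteDimensional ℂ 𝔤]

lemma eq_zero_of_dualExt {y : R ⊗[ℂ] 𝔤} (h : ∀ l, dualExt R l y = 0) : y = 0 := by
  rw [eq_sum_dualExt y]
  simp [h]

/-- A complement of `W` splits the inclusion after base change too, so the linear forms vanishing on
`W` still cut out `R ⊗ W`. This turns membership into equations that `R`-points can satisfy. -/
lemma mem_baseChange_of_dualExt {W : Submodule ℂ 𝔤} {y : R ⊗[ℂ] 𝔤}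
    (h : ∀ l : Module.Dual ℂ 𝔤, (∀ w ∈ W, l w = 0) → dualExt R l y = 0) :
    y ∈ W.baseChange R := by
  obtain ⟨C, hC⟩ := W.exists_isCompl
  have h0 : (Submodule.projection C W hC.symm).baseChange R y = 0 := by
    refine eq_zero_of_dualExt fun l => ?_
    rw [dualExt_baseChange]
    refine h _ fun w hw => ?_
    rw [LinearMap.comp_apply, (Submodule.projection_apply_eq_zero_iff _).mpr hw, map_zero]
  have h1 : y = (Submodule.projection W C hC).baseChange R y := by
    have := LinearMap.congr_fun (congrArg (LinearMap.baseChange R)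
      (Submodule.projection_add_projection_eq_id hC)) y
    rw [LinearMap.baseChange_add, LinearMap.add_apply, h0, add_zero] at this
    rw [this]
    simp
  rw [h1]
  exact baseChange_apply_mem (fun x => Submodule.projection_apply_mem hC x) y

/-- An affine-linear condition on `S` holds on `R`-points. -/
lemma points_map_sub_mem {S : Subgroup (LinearMap.GeneralLinearGroup ℂ 𝔤)} {x x₀ : 𝔤}
    {W : Submodule ℂ 𝔤} (h : ∀ σ ∈ S, σ.1 x - x₀ ∈ W)
    {φ : LinearMap.GeneralLinearGroup R (R ⊗[ℂ] 𝔤)} (hφ : φ ∈ points S R) :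
    φ.1 (1 ⊗ₜ x) - 1 ⊗ₜ x₀ ∈ W.baseChange R := by
  refine mem_baseChange_of_dualExt fun l hl => ?_
  have := hφ (MvPolynomial.X (.inl (x, l)) - MvPolynomial.C (l x₀)) (fun σ hσ => by
    have h1 := hl _ (h σ hσ)
    rw [map_sub] at h1
    simpa [coordC] using h1)
  rw [map_sub, dualExt_tmul, one_mul]
  simpa [coord] using this

lemma points_map_mem {S : Subgroup (LinearMap.GeneralLinearGroup ℂ 𝔤)} {x : 𝔤}
    {W : Submodule ℂ 𝔤} (h : ∀ σ ∈ S, σ.1 x ∈ W)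
    {φ : LinearMap.GeneralLinearGroup R (R ⊗[ℂ] 𝔤)} (hφ : φ ∈ points S R) :
    φ.1 (1 ⊗ₜ x) ∈ W.baseChange R := by
  simpa using points_map_sub_mem (x₀ := 0) (by simpa using h) hφ

end RPoints

section LiePoints

variable {𝔤 : Type*} [LieRing 𝔤] [LieAlgebra ℂ 𝔤] [FiniteDimensional ℂ 𝔤]
variable {R : Type*} [CommRing R] [Algebra ℂ R]

lemma dualExt_lie (l : Module.Dual ℂ 𝔤) (y z : R ⊗[ℂ] 𝔤) :
    dualExt R l ⁅y, z⁆ = ∑ j, ∑ k, dualExt R ((Module.finBasis ℂ 𝔤).coord j) y *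
      dualExt R ((Module.finBasis ℂ 𝔤).coord k) z *
        algebraMap ℂ R (l ⁅Module.finBasis ℂ 𝔤 j, Module.finBasis ℂ 𝔤 k⁆) := by
  conv_lhs => rw [eq_sum_dualExt y, eq_sum_dualExt z]
  rw [sum_lie_sum]
  simp only [map_sum, LieAlgebra.ExtendScalars.bracket_tmul, dualExt_tmul]

lemma points_map_lie {S : Subgroup (LinearMap.GeneralLinearGroup ℂ 𝔤)}
    (h : ∀ σ ∈ S, ∀ x y : 𝔤, σ.1 ⁅x, y⁆ = ⁅σ.1 x, σ.1 y⁆)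
    {φ : LinearMap.GeneralLinearGroup R (R ⊗[ℂ] 𝔤)} (hφ : φ ∈ points S R)
    (y z : R ⊗[ℂ] 𝔤) : φ.1 ⁅y, z⁆ = ⁅φ.1 y, φ.1 z⁆ := by
  have h1 : ∀ x x' : 𝔤, φ.1 (1 ⊗ₜ ⁅x, x'⁆) = ⁅φ.1 (1 ⊗ₜ x), φ.1 (1 ⊗ₜ x')⁆ := by
    intro x x'
    refine sub_eq_zero.mp (eq_zero_of_dualExt fun l => ?_)
    -- Preservation of the bracket is a quadratic equation in the matrix coefficients, with the
    -- structure constants as coefficients.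
    have := hφ (MvPolynomial.X (.inl (⁅x, x'⁆, l)) - ∑ j, ∑ k,
      MvPolynomial.X (.inl (x, (Module.finBasis ℂ 𝔤).coord j)) *
      MvPolynomial.X (.inl (x', (Module.finBasis ℂ 𝔤).coord k)) *
        MvPolynomial.C (l ⁅Module.finBasis ℂ 𝔤 j, Module.finBasis ℂ 𝔤 k⁆)) (fun σ hσ => by
      simp only [map_sub, MvPolynomial.aeval_X, coordC, map_sum, map_mul, MvPolynomial.aeval_C]
      rw [h σ hσ, sub_eq_zero]
      conv_lhs => rw [← (Module.finBasis ℂ 𝔤).sum_repr (σ.1 x),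
        ← (Module.finBasis ℂ 𝔤).sum_repr (σ.1 x')]
      simp only [sum_lie_sum, map_sum, smul_lie, lie_smul, map_smul,
        smul_eq_mul, Module.Basis.coord_apply]
      refine Finset.sum_congr rfl fun j _ => Finset.sum_congr rfl fun k _ => ?_
      rw [mul_assoc, mul_left_comm]
      rfl)
    simp only [map_sub, MvPolynomial.aeval_X, coord, map_sum, map_mul, MvPolynomial.aeval_C] at this
    rw [map_sub, dualExt_lie]
    exact this
  have htm : ∀ (r : R) (x : 𝔤), (r ⊗ₜ[ℂ] x : R ⊗[ℂ] 𝔤) = r • ((1 : R) ⊗ₜ[ℂ] x) := by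
    intro r x
    simp [TensorProduct.smul_tmul']
  induction y with
  | zero => simp
  | add a b ha hb => simp only [add_lie, map_add, ha, hb]
  | tmul r x =>
    induction z with
    | zero => simp
    | add a b ha hb => simp only [lie_add, map_add, ha, hb]
    | tmul r' x' =>
      rw [LieAlgebra.ExtendScalars.bracket_tmul, htm, map_smul, h1, htm r, htm r', map_smul,
        map_smul, smul_lie, lie_smul, smul_smul]

end LiePoints

/-! ### The principal grading over a `ℂ`-algebra -/

section Sl2

variable {R : Type*} [CommRing R] [Algebra ℂ R]

lemma isUnit_intCast {n : ℤ} (hn : n ≠ 0) : IsUnit (n : R) := by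
  have h : IsUnit (n : ℂ) := IsUnit.mk0 _ (by exact_mod_cast hn)
  simpa using h.map (algebraMap ℂ R)

/-- A lowest weight vector of positive weight on which `e` acts nilpotently is zero. -/
lemma eq_zero_of_lowest_weight_pos {L : Type*} [LieRing L] [LieAlgebra R L] {h e f y : L}
    (hef : ⁅e, f⁆ = h) (he : ⁅h, e⁆ = 2 • e) (hf : ⁅h, f⁆ = -(2 • f)) {k : ℤ} (hk : 0 < k)
    (hy : ⁅h, y⁆ = (k : R) • y) (hfy : ⁅f, y⁆ = 0) {N : ℕ}
    (hN : (LieModule.toEnd R L L e ^ N) y = 0) : y = 0 := by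
  by_contra hne
  have hh : h ≠ 0 := by
    rintro rfl
    rw [zero_lie] at hy
    exact hne ((isUnit_intCast hk.ne').smul_eq_zero.mp hy.symm)
  have t : IsSl2Triple h e f := ⟨hh, hef, he, hf⟩
  -- In the opposite triple `y` is a highest weight vector of weight `-k`, and `e` is the lowering
  -- operator.
  have P : t.symm.HasPrimitiveVectorWith y (-(k : R)) := ⟨hne, by rw [neg_lie, hy, neg_smul], hfy⟩
  induction N with
  | zero => exact hne (by simpa using hN)
  | succ N ih =>
    refine ih ?_
    -- Applying `f` to `e^{N+1} y = 0` gives `(N+1)(-k-N) e^N y = 0`. The factor is a nonzero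
    -- integer because `k > 0`, hence a unit, so the exponent drops.
    have h1 := P.lie_e_pow_succ_toEnd_f N
    rw [hN, lie_zero] at h1
    have h2 : ((N : R) + 1) * (-(k : R) - N) = ((((N : ℤ) + 1) * (-k - N) : ℤ) : R) := by
      push_cast
      ring
    rw [h2] at h1
    refine (isUnit_intCast ?_).smul_eq_zero.mp h1.symm
    have : (N : ℤ) + 1 ≠ 0 := by omega
    have : -k - (N : ℤ) ≠ 0 := by omega
    positivity

end Sl2

/-! ### Homogeneous elements and principal `𝔰𝔩₂`-triples over `R` -/

section ScalarExtension

open LieAlgebra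

variable {𝔤 : Type*} [LieRing 𝔤] [LieAlgebra ℂ 𝔤] [FiniteDimensional ℂ 𝔤]
  [LieAlgebra.IsSemisimple ℂ 𝔤]
  {H : LieSubalgebra ℂ 𝔤} [H.IsCartanSubalgebra]
  (Δ : (LieAlgebra.IsKilling.rootSystem H).Base)
  (R : Type*) [CommRing R] [Algebra ℂ R]

/-- The filtration `R ⊗ 𝔤^k` of `R ⊗ 𝔤`. -/
def filtrationExt (k : ℤ) : Submodule R (R ⊗[ℂ] 𝔤) := (filtration Δ k).baseChange R

variable {R}

/-- An element of `R ⊗ 𝔤` is homogeneous of degree `k` for the principal grading. -/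
def HasDegree (k : ℤ) (x : R ⊗[ℂ] 𝔤) : Prop :=
  ⁅(1 : R) ⊗ₜ[ℂ] (gradingElement Δ : 𝔤), x⁆ = (k : R) • x

variable {Δ}

lemma filtrationExt_antitone : Antitone (filtrationExt Δ R) := fun _ _ h =>
  Submodule.baseChange_mono R (filtration_antitone Δ h)

lemma mem_filtrationExt_of_le {j k : ℤ} (h : j ≤ k) {x : R ⊗[ℂ] 𝔤}
    (hx : x ∈ filtrationExt Δ R k) : x ∈ filtrationExt Δ R j :=
  filtrationExt_antitone h hx

lemma tmul_mem_filtrationExt {k : ℤ} (r : R) {x : 𝔤} (hx : x ∈ gradedPiece Δ k) :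
    r ⊗ₜ[ℂ] x ∈ filtrationExt Δ R k :=
  Submodule.tmul_mem_baseChange_of_mem r (gradedPiece_le_filtration Δ le_rfl hx)

lemma lie_mem_filtrationExt {j k : ℤ} {x y : R ⊗[ℂ] 𝔤} (hx : x ∈ filtrationExt Δ R j)
    (hy : y ∈ filtrationExt Δ R k) : ⁅x, y⁆ ∈ filtrationExt Δ R (j + k) := by
  refine baseChange_induction (p := fun x => ⁅x, y⁆ ∈ filtrationExt Δ R (j + k)) (by simp)
    (fun a b ha hb => by rw [add_lie]; exact add_mem ha hb) (fun r a ha => ?_) hx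
  refine baseChange_induction (p := fun y => ⁅r ⊗ₜ[ℂ] a, y⁆ ∈ filtrationExt Δ R (j + k)) (by simp)
    (fun c b hc hb => by rw [lie_add]; exact add_mem hc hb) (fun s b hb => ?_) hy
  rw [ExtendScalars.bracket_tmul]
  exact Submodule.tmul_mem_baseChange_of_mem _ (lie_mem_filtration Δ ha hb)

lemma lie_mem_filtrationExt' {j k l : ℤ} (h : l ≤ j + k) {x y : R ⊗[ℂ] 𝔤}
    (hx : x ∈ filtrationExt Δ R j) (hy : y ∈ filtrationExt Δ R k) :
    ⁅x, y⁆ ∈ filtrationExt Δ R l :=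
  mem_filtrationExt_of_le h (lie_mem_filtrationExt hx hy)

lemma hasDegree_tmul {k : ℤ} (r : R) {x : 𝔤} (hx : x ∈ gradedPiece Δ k) :
    HasDegree Δ k (r ⊗ₜ[ℂ] x) := by
  rw [HasDegree, ExtendScalars.bracket_tmul, lie_gradingElement Δ hx, one_mul,
    TensorProduct.tmul_smul, TensorProduct.smul_tmul', TensorProduct.smul_tmul',
    Algebra.smul_def, map_intCast, smul_eq_mul]

lemma HasDegree.add {k : ℤ} {x y : R ⊗[ℂ] 𝔤} (hx : HasDegree Δ k x) (hy : HasDegree Δ k y) :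
    HasDegree Δ k (x + y) := by
  rw [HasDegree, lie_add, hx, hy, smul_add]

lemma hasDegree_zero (k : ℤ) : HasDegree Δ k (0 : R ⊗[ℂ] 𝔤) := by
  rw [HasDegree, lie_zero, smul_zero]

lemma HasDegree.sum {ι : Type*} {s : Finset ι} {k : ℤ} {x : ι → R ⊗[ℂ] 𝔤}
    (h : ∀ i, HasDegree Δ k (x i)) : HasDegree Δ k (∑ i ∈ s, x i) := by
  rw [HasDegree, lie_sum, Finset.smul_sum]
  exact Finset.sum_congr rfl fun i _ => h i

lemma HasDegree.lie {j k : ℤ} {x y : R ⊗[ℂ] 𝔤} (hx : HasDegree Δ j x) (hy : HasDegree Δ k y) :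
    HasDegree Δ (j + k) ⁅x, y⁆ := by
  rw [HasDegree, leibniz_lie, hx, hy, smul_lie, lie_smul, ← add_smul, Int.cast_add]

lemma hasDegree_of_mem_baseChange {k : ℤ} {x : R ⊗[ℂ] 𝔤}
    (hx : x ∈ (gradedPiece Δ k).baseChange R) : HasDegree Δ k x :=
  baseChange_induction (p := HasDegree Δ k) (hasDegree_zero k) (fun _ _ => HasDegree.add)
    (fun r _ hx => hasDegree_tmul r hx) hx

lemma exists_eq_add_of_mem_filtrationExt {k : ℤ} {x : R ⊗[ℂ] 𝔤}
    (hx : x ∈ filtrationExt Δ R k) : ∃ a ∈ (gradedPiece Δ k).baseChange R,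
      ∃ b ∈ filtrationExt Δ R (k + 1), x = a + b := by
  refine baseChange_induction (p := fun x => ∃ a ∈ (gradedPiece Δ k).baseChange R,
      ∃ b ∈ filtrationExt Δ R (k + 1), x = a + b) ⟨0, zero_mem _, 0, zero_mem _, by simp⟩
    ?_ (fun r x hx => ?_) hx
  · rintro _ _ ⟨a, ha, b, hb, rfl⟩ ⟨c, hc, d, hd, rfl⟩
    exact ⟨a + c, add_mem ha hc, b + d, add_mem hb hd, by abel⟩
  · rw [filtration_eq_sup, Submodule.mem_sup] at hx
    obtain ⟨a, ha, b, hb, rfl⟩ := hx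
    exact ⟨r ⊗ₜ a, Submodule.tmul_mem_baseChange_of_mem _ ha, r ⊗ₜ b,
      Submodule.tmul_mem_baseChange_of_mem _ hb, TensorProduct.tmul_add _ _ _⟩

/-- If `x ∈ 𝔤^l` and `[ρ^∨, x] - j x ∈ 𝔤^m` with `j ∉ [l, m)` then `x ∈ 𝔤^m`. -/
lemma mem_filtrationExt_of_lie_sub_mem {j l m : ℤ} (hlm : l ≤ m)
    (hj : ∀ i, l ≤ i → i < m → i ≠ j) {x : R ⊗[ℂ] 𝔤} (hx : x ∈ filtrationExt Δ R l)
    (h : ⁅(1 : R) ⊗ₜ[ℂ] (gradingElement Δ : 𝔤), x⁆ - (j : R) • x ∈ filtrationExt Δ R m) :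
    x ∈ filtrationExt Δ R m := by
  suffices ∀ i, l ≤ i → i ≤ m → x ∈ filtrationExt Δ R i from this m hlm le_rfl
  intro i hi
  induction i, hi using Int.leInduction with
  | base => exact fun _ => hx
  | succ i hi ih =>
    intro him
    obtain ⟨a, ha, b, hb, rfl⟩ := exists_eq_add_of_mem_filtrationExt (ih (by omega))
    refine add_mem ?_ hb
    have hρb : ⁅(1 : R) ⊗ₜ[ℂ] (gradingElement Δ : 𝔤), b⁆ ∈ filtrationExt Δ R (i + 1) :=
      lie_mem_filtrationExt' (by omega)
        (tmul_mem_filtrationExt 1 (mem_gradedPiece_of_gradingElement Δ)) hb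
    have h2 := sub_mem (sub_mem (mem_filtrationExt_of_le him h) hρb)
      (Submodule.smul_mem _ (-(j : R)) hb)
    -- After the contribution of `b` is removed, the degree `i` part survives with the factor `i -
    -- j`, a unit.
    have h3 : ⁅(1 : R) ⊗ₜ[ℂ] (gradingElement Δ : 𝔤), a + b⁆ - (j : R) • (a + b) -
        ⁅(1 : R) ⊗ₜ[ℂ] (gradingElement Δ : 𝔤), b⁆ - -(j : R) • b = ((i - j : ℤ) : R) • a := by
      rw [lie_add, hasDegree_of_mem_baseChange ha, Int.cast_sub, sub_smul, smul_add, neg_smul]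
      abel
    rw [h3] at h2
    exact (Submodule.smul_mem_iff_of_isUnit _
      (isUnit_intCast (sub_ne_zero.mpr (hj i hi (by omega))))).mp h2

lemma eq_zero_of_forall_mem_filtrationExt {x : R ⊗[ℂ] 𝔤} {l : ℤ}
    (h : ∀ k, l ≤ k → x ∈ filtrationExt Δ R k) : x = 0 := by
  obtain ⟨N, -, hN⟩ := exists_filtration_eq_bot Δ
  have := h (max (N + 1) l) (le_max_right _ _)
  rw [filtrationExt, hN _ (lt_of_lt_of_le (lt_add_one N) (le_max_left _ _)),
    Submodule.baseChange_bot] at this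
  exact (Submodule.mem_bot R).mp this

variable (Δ R) in
lemma exists_filtrationExt_eq_top : ∃ l, ∀ x : R ⊗[ℂ] 𝔤, x ∈ filtrationExt Δ R l := by
  obtain ⟨N, -, hN⟩ := exists_filtration_eq_top Δ
  refine ⟨-N, fun x => ?_⟩
  rw [filtrationExt, hN, Submodule.baseChange_top]
  trivial

/-- Since `ad ρ^∨ - j` kills `x` and is invertible in all degrees from `l` on, `x` lies in every
later step. This is how leading terms are shown to vanish, without a direct sum decomposition of `R
⊗ 𝔤`. -/
lemma HasDegree.eq_zero_of_mem {j l : ℤ} (hjl : j < l) {x : R ⊗[ℂ] 𝔤} (hx : HasDegree Δ j x)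
    (hxl : x ∈ filtrationExt Δ R l) : x = 0 := by
  refine eq_zero_of_forall_mem_filtrationExt (Δ := Δ) (l := l) fun k hk => ?_
  refine mem_filtrationExt_of_lie_sub_mem (j := j) hk (fun i hi _ => by omega) hxl ?_
  rw [hx, sub_self]
  exact zero_mem _

variable (Δ R) in
lemma exists_forall_hasDegree_eq_zero :
    ∃ N : ℤ, ∀ j, N < |j| → ∀ x : R ⊗[ℂ] 𝔤, HasDegree Δ j x → x = 0 := by
  obtain ⟨l, hl⟩ := exists_filtrationExt_eq_top Δ R
  obtain ⟨N, hN0, hN⟩ := exists_filtration_eq_bot Δ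
  refine ⟨max N |l|, fun j hj x hx => ?_⟩
  have h1 : N < |j| := lt_of_le_of_lt (le_max_left _ _) hj
  have h2 : |l| < |j| := lt_of_le_of_lt (le_max_right _ _) hj
  rcases le_total j 0 with h0 | h0
  · rw [abs_of_nonpos h0] at h2
    have := neg_abs_le l
    exact hx.eq_zero_of_mem (by omega) (hl x)
  · rw [abs_of_nonneg h0] at h1 h2
    have h3 : x ∈ filtrationExt Δ R j := by
      refine mem_filtrationExt_of_lie_sub_mem (j := j) (l := l) ?_ (fun i _ hi => by omega) (hl x) ?_
      · have := le_abs_self l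
        omega
      · rw [hx, sub_self]
        exact zero_mem _
    rw [filtrationExt, hN j h1, Submodule.baseChange_bot] at h3
    exact (Submodule.mem_bot R).mp h3

/-- Each application of `ad a` shifts the degree by `d = ±1`, and degrees of large absolute value
contain only `0`. -/
lemma HasDegree.exists_pow_toEnd_eq_zero {d k : ℤ} (hd : d = 1 ∨ d = -1) {a x : R ⊗[ℂ] 𝔤}
    (ha : HasDegree Δ d a) (hx : HasDegree Δ k x) :
    ∃ n : ℕ, (LieModule.toEnd R (R ⊗[ℂ] 𝔤) (R ⊗[ℂ] 𝔤) a ^ n) x = 0 := by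
  have hpow : ∀ n : ℕ, HasDegree Δ (k + n * d)
      ((LieModule.toEnd R (R ⊗[ℂ] 𝔤) (R ⊗[ℂ] 𝔤) a ^ n) x) := by
    intro n
    induction n with
    | zero => simpa using hx
    | succ n ih =>
      rw [pow_succ', Module.End.mul_apply, LieModule.toEnd_apply_apply]
      have := ha.lie ih
      rwa [show d + (k + n * d) = k + (n + 1 : ℕ) * d by push_cast; ring] at this
  obtain ⟨N, hN⟩ := exists_forall_hasDegree_eq_zero Δ R
  refine ⟨(|N| + |k| + 1).toNat, hN _ ?_ _ (hpow _)⟩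
  have h1 := le_abs_self N
  have h2 := le_abs_self k
  have h3 := neg_abs_le k
  have h4 := abs_nonneg N
  rw [Int.toNat_of_nonneg (by omega)]
  rcases hd with rfl | rfl
  · refine lt_of_lt_of_le ?_ (le_abs_self _)
    omega
  · refine lt_of_lt_of_le ?_ (neg_le_abs _)
    omega

namespace ChevalleyGenerators

variable (C : ChevalleyGenerators Δ)

/-- The coefficients `cᵢ` with `2 ρ^∨ = ∑ cᵢ αᵢ^∨`. -/
def coeff (Δ : (LieAlgebra.IsKilling.rootSystem H).Base) (i : Δ.support) : ℂ :=
  Δ.toCoweightBasis.repr ((2 : ℂ) • gradingElement Δ) i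

/-- The principal nilpotent element `∑ uᵢ fᵢ`. -/
def principalF (u : Δ.support → Rˣ) : R ⊗[ℂ] 𝔤 := ∑ i, (u i : R) ⊗ₜ[ℂ] C.f i

/-- The element `∑ uᵢ⁻¹ cᵢ eᵢ`, which forms an `𝔰𝔩₂`-triple with `2 ρ^∨` and `∑ uᵢ fᵢ`. -/
def principalE (u : Δ.support → Rˣ) : R ⊗[ℂ] 𝔤 :=
  ∑ i, ((u i)⁻¹ : Rˣ).1 ⊗ₜ[ℂ] (coeff Δ i • C.e i)

lemma e_mem_gradedPiece (i : Δ.support) : C.e i ∈ gradedPiece Δ 1 :=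
  rootSpace_simpleRoot_le Δ i (C.e_mem i)

lemma f_mem_gradedPiece (i : Δ.support) : C.f i ∈ gradedPiece Δ (-1) :=
  rootSpace_neg_simpleRoot_le Δ i (C.f_mem i)

lemma hasDegree_principalE (u : Δ.support → Rˣ) : HasDegree Δ 1 (C.principalE u) :=
  HasDegree.sum fun i => hasDegree_tmul _ (Submodule.smul_mem _ _ (C.e_mem_gradedPiece i))

lemma hasDegree_principalF (u : Δ.support → Rˣ) : HasDegree Δ (-1) (C.principalF u) :=
  HasDegree.sum fun i => hasDegree_tmul _ (C.f_mem_gradedPiece i)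

/-- The mixed brackets vanish, the units cancel in the others, and `∑ cᵢ αᵢ^∨ = 2ρ^∨` remains. -/
lemma lie_principalE_principalF (u : Δ.support → Rˣ) :
    ⁅C.principalE u, C.principalF u⁆ = 2 • ((1 : R) ⊗ₜ[ℂ] (gradingElement Δ : 𝔤)) := by
  have h2 : ((2 : ℂ) • gradingElement Δ : H) = ∑ i, coeff Δ i • Δ.toCoweightBasis i :=
    (Δ.toCoweightBasis.sum_repr _).symm
  have h3 : (2 : ℂ) • (gradingElement Δ : 𝔤) =
      ∑ i, coeff Δ i • ((Δ.toCoweightBasis i : H) : 𝔤) := by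
    have := congrArg (fun h : H => (h : 𝔤)) h2
    simpa using this
  have h4 : (2 • ((1 : R) ⊗ₜ[ℂ] (gradingElement Δ : 𝔤)) : R ⊗[ℂ] 𝔤) =
      (1 : R) ⊗ₜ[ℂ] ((2 : ℂ) • (gradingElement Δ : 𝔤)) := by
    rw [two_smul, two_smul, TensorProduct.tmul_add]
  rw [h4, h3, principalE, principalF, sum_lie_sum, TensorProduct.tmul_sum]
  refine Finset.sum_congr rfl fun i _ => ?_
  rw [Finset.sum_eq_single i]
  · rw [ExtendScalars.bracket_tmul, smul_lie, C.lie_e_f, Units.inv_mul]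
  · intro j _ hj
    rw [ExtendScalars.bracket_tmul, smul_lie, C.lie_e_f_of_ne i j hj.symm, smul_zero,
      TensorProduct.tmul_zero]
  · simp

/-- An element of degree `k` has weight `2k` for `h = 2ρ^∨`, and a vector killed by `F` is a lowest
weight vector, which cannot have positive weight. -/
lemma eq_zero_of_lie_principalF (u : Δ.support → Rˣ) {k : ℤ} (hk : 0 < k) {x : R ⊗[ℂ] 𝔤}
    (hx : HasDegree Δ k x) (h : ⁅C.principalF u, x⁆ = 0) : x = 0 := by
  obtain ⟨N, hN⟩ := (C.hasDegree_principalE u).exists_pow_toEnd_eq_zero (.inl rfl) hx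
  have hE := C.hasDegree_principalE u
  have hF := C.hasDegree_principalF u
  rw [HasDegree] at hE hF hx
  refine eq_zero_of_lowest_weight_pos (R := R) (C.lie_principalE_principalF u) ?_ ?_
    (k := 2 * k) (by omega) ?_ h hN
  · rw [nsmul_lie, hE, Int.cast_one, one_smul]
  · rw [nsmul_lie, hF, Int.cast_neg, Int.cast_one, neg_smul, one_smul, smul_neg]
  · rw [nsmul_lie, hx, two_smul, ← add_smul]
    congr 1
    push_cast
    ring

/-- The mirror image, obtained from the triple with `e` and `f` exchanged and `h` negated. -/
lemma eq_zero_of_lie_principalE (u : Δ.support → Rˣ) {k : ℤ} (hk : k < 0) {x : R ⊗[ℂ] 𝔤}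
    (hx : HasDegree Δ k x) (h : ⁅C.principalE u, x⁆ = 0) : x = 0 := by
  obtain ⟨N, hN⟩ := (C.hasDegree_principalF u).exists_pow_toEnd_eq_zero (.inr rfl) hx
  have hE := C.hasDegree_principalE u
  have hF := C.hasDegree_principalF u
  rw [HasDegree] at hE hF hx
  refine eq_zero_of_lowest_weight_pos (R := R)
    (h := -(2 • ((1 : R) ⊗ₜ[ℂ] (gradingElement Δ : 𝔤)))) ?_ ?_ ?_
    (k := -(2 * k)) (by omega) ?_ h hN
  · rw [← lie_skew, C.lie_principalE_principalF u]
  · rw [neg_lie, nsmul_lie, hF, Int.cast_neg, Int.cast_one, neg_smul, one_smul, smul_neg, neg_neg]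
  · rw [neg_lie, nsmul_lie, hE, Int.cast_one, one_smul]
  · rw [neg_lie, nsmul_lie, hx, two_smul, ← add_smul, ← neg_smul]
    congr 1
    push_cast
    ring

end ChevalleyGenerators

end ScalarExtension

/-! ### Gauge transformations that fix an oper connection -/

section Gauge

lemma derExt_one_tmul {𝔤 : Type*} [AddCommGroup 𝔤] [Module ℂ 𝔤] {R : Type*} [CommRing R]
    [Algebra ℂ R] (D : Derivation ℂ R R) (x : 𝔤) : derExt 𝔤 D (1 ⊗ₜ x) = 0 := by
  rw [derExt, LinearMap.rTensor_tmul]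
  simp

open LieAlgebra

variable {𝔤 : Type*} [LieRing 𝔤] [LieAlgebra ℂ 𝔤] [FiniteDimensional ℂ 𝔤]
  [LieAlgebra.IsSemisimple ℂ 𝔤]
  {H : LieSubalgebra ℂ 𝔤} [H.IsCartanSubalgebra]
  (Δ : (LieAlgebra.IsKilling.rootSystem H).Base)
  {R : Type*} [CommRing R] [Algebra ℂ R]

/-- The properties of the action of an `R`-point of the Borel subgroup on `R ⊗ 𝔤`. -/
structure IsBorelAutomorphism (b : Module.End R (R ⊗[ℂ] 𝔤)) : Prop where
  map_lie : ∀ x y, b ⁅x, y⁆ = ⁅b x, b y⁆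
  map_mem : ∀ {k : ℤ} {x : R ⊗[ℂ] 𝔤}, x ∈ filtrationExt Δ R k → b x ∈ filtrationExt Δ R k
  map_cartan : ∀ h ∈ H, b (1 ⊗ₜ h) - 1 ⊗ₜ h ∈ filtrationExt Δ R 1
  map_neg_simpleRoot : ∀ i, ∀ x ∈ rootSpace H ⇑(-simpleRoot Δ i), b (1 ⊗ₜ x) ∈
    ((rootSpace H ⇑(-simpleRoot Δ i)).toSubmodule ⊔ filtration Δ 0).baseChange R

/-- All four properties are expressed by regular functions on `GL(𝔤)` vanishing on `B`, and
`R`-points satisfy these by definition. -/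
lemma isBorelAutomorphism_of_mem_points {φ : LinearMap.GeneralLinearGroup R (R ⊗[ℂ] 𝔤)}
    (hφ : φ ∈ points (borelSubgroup Δ) R) : IsBorelAutomorphism Δ φ.1 where
  map_lie := points_map_lie
    (fun _ hσ => map_lie_of_mem_adjointGroup (borelSubgroup_le Δ hσ)) hφ
  map_mem := map_baseChange_mem_of_one_tmul φ.1 fun _ hx =>
    points_map_mem (fun _ hσ => mem_filtration_of_mem_borelSubgroup Δ hσ hx) hφ
  map_cartan _ hh :=
    points_map_sub_mem (fun _ hσ => map_sub_self_mem_of_mem_borelSubgroup Δ hσ hh) hφ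
  map_neg_simpleRoot i _ hx :=
    points_map_mem (fun _ hσ => map_neg_simpleRoot_of_mem_borelSubgroup Δ hσ i hx) hφ

variable {Δ}

lemma rootProj_baseChange_eq_zero (i : Δ.support) {x : R ⊗[ℂ] 𝔤}
    (hx : x ∈ filtrationExt Δ R 0) :
    (rootProj H ⇑(-simpleRoot Δ i)).baseChange R x = 0 :=
  baseChange_induction (p := fun x => (rootProj H ⇑(-simpleRoot Δ i)).baseChange R x = 0)
    (map_zero _) (fun a b ha hb => by rw [map_add, ha, hb, add_zero])
    (fun r x hx => by
      rw [LinearMap.baseChange_tmul, rootProj_neg_simpleRoot_of_mem_filtration Δ i hx,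
        TensorProduct.tmul_zero]) hx

lemma sub_rootProj_baseChange_mem (i : Δ.support) {x : R ⊗[ℂ] 𝔤}
    (hx : x ∈ ((rootSpace H ⇑(-simpleRoot Δ i)).toSubmodule ⊔ filtration Δ 0).baseChange R) :
    x - (rootProj H ⇑(-simpleRoot Δ i)).baseChange R x ∈ filtrationExt Δ R 0 := by
  refine baseChange_induction
    (p := fun x => x - (rootProj H ⇑(-simpleRoot Δ i)).baseChange R x ∈ filtrationExt Δ R 0)
    (by simp) (fun a b ha hb => ?_) (fun r x hx => ?_) hx
  · rw [map_add, add_sub_add_comm]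
    exact add_mem ha hb
  · obtain ⟨a, ha, b, hb, rfl⟩ := Submodule.mem_sup.mp hx
    rw [LinearMap.baseChange_tmul, map_add, rootProj_apply_of_mem ha,
      rootProj_neg_simpleRoot_of_mem_filtration Δ i hb, ← TensorProduct.tmul_sub, add_zero,
      add_sub_cancel_left]
    exact Submodule.tmul_mem_baseChange_of_mem r hb

lemma sub_sum_rootProj_baseChange_mem {x : R ⊗[ℂ] 𝔤} (hx : x ∈ filtrationExt Δ R (-1)) :
    x - ∑ i, (rootProj H ⇑(-simpleRoot Δ i)).baseChange R x ∈ filtrationExt Δ R 0 := by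
  refine baseChange_induction (p := fun x =>
    x - ∑ i, (rootProj H ⇑(-simpleRoot Δ i)).baseChange R x ∈ filtrationExt Δ R 0)
    (by simp) (fun a b ha hb => ?_) (fun r x hx => ?_) hx
  · simp only [map_add, Finset.sum_add_distrib]
    rw [add_sub_add_comm]
    exact add_mem ha hb
  · simp only [LinearMap.baseChange_tmul]
    rw [← TensorProduct.tmul_sum, ← TensorProduct.tmul_sub]
    exact Submodule.tmul_mem_baseChange_of_mem r (sub_sum_rootProj_mem_filtration Δ hx)

lemma ChevalleyGenerators.exists_eq_smul (C : ChevalleyGenerators Δ) (i : Δ.support)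
    {x : R ⊗[ℂ] 𝔤} (hx : x ∈ (rootSpace H ⇑(-simpleRoot Δ i)).toSubmodule.baseChange R) :
    ∃ r : R, x = r ⊗ₜ C.f i := by
  refine baseChange_induction (p := fun x => ∃ r : R, x = r ⊗ₜ C.f i) ⟨0, by simp⟩ ?_ ?_ hx
  · rintro _ _ ⟨r, rfl⟩ ⟨s, rfl⟩
    exact ⟨r + s, (TensorProduct.add_tmul _ _ _).symm⟩
  · intro r y hy
    rw [C.rootSpace_neg_eq_span] at hy
    obtain ⟨c, rfl⟩ := Submodule.mem_span_singleton.mp hy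
    exact ⟨c • r, by rw [TensorProduct.tmul_smul, TensorProduct.smul_tmul']⟩

lemma ChevalleyGenerators.rootProj_f_of_ne (C : ChevalleyGenerators Δ) {i j : Δ.support}
    (hij : i ≠ j) : rootProj H ⇑(-simpleRoot Δ j) (C.f i) = 0 := by
  refine rootProj_apply_of_ne (fun h => hij ?_) (C.f_mem i)
  have h2 := DFunLike.coe_injective h
  rw [simpleRoot_eq_basis, simpleRoot_eq_basis, neg_inj] at h2
  exact Δ.toWeightBasis.injective h2

namespace IsBorelAutomorphism

variable {b : Module.End R (R ⊗[ℂ] 𝔤)}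

/-- If `b` is trivial to leading order at `p ∈ 𝔤_d` and on `𝔤_{d+k}`, and `ad p` is injective in
degree `k`, then `b` is trivial to leading order on `𝔤_k`. -/
lemma map_sub_mem_step (hb : IsBorelAutomorphism Δ b) {d k : ℤ} {p : 𝔤} (hp : p ∈ gradedPiece Δ d)
    (hbp : b (1 ⊗ₜ p) - 1 ⊗ₜ p ∈ filtrationExt Δ R (d + 1))
    (hinj : ∀ w : R ⊗[ℂ] 𝔤, HasDegree Δ k w → ⁅(1 : R) ⊗ₜ[ℂ] p, w⁆ = 0 → w = 0)
    (ih : ∀ x ∈ gradedPiece Δ (d + k), b (1 ⊗ₜ x) - 1 ⊗ₜ x ∈ filtrationExt Δ R (d + k + 1))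
    {x : 𝔤} (hx : x ∈ gradedPiece Δ k) :
    b (1 ⊗ₜ x) - 1 ⊗ₜ x ∈ filtrationExt Δ R (k + 1) := by
  have hP := tmul_mem_filtrationExt (1 : R) hp
  have hX := tmul_mem_filtrationExt (1 : R) hx
  have hbX := hb.map_mem hX
  obtain ⟨w, hw, v, hv, hwv⟩ := exists_eq_add_of_mem_filtrationExt (sub_mem hbX hX)
  have hwd := hasDegree_of_mem_baseChange hw
  have h1 := ih _ (lie_mem_gradedPiece Δ hp hx)
  have h2 : (1 : R) ⊗ₜ[ℂ] ⁅p, x⁆ = ⁅(1 : R) ⊗ₜ[ℂ] p, (1 : R) ⊗ₜ[ℂ] x⁆ := by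
    rw [ExtendScalars.bracket_tmul, one_mul]
  rw [h2, hb.map_lie] at h1
  -- Here `[p, w] = (b[p, x] - [p, x]) - [bp - p, bx] - [p, v]`, and each term lies in `𝔤^{d+k+1}`;
  -- being homogeneous of degree `d + k`, the left side vanishes.
  have h3 : ⁅(1 : R) ⊗ₜ[ℂ] p, w⁆ ∈ filtrationExt Δ R (d + k + 1) := by
    have h4 := lie_mem_filtrationExt' (l := d + k + 1) (by omega) hbp hbX
    have h5 := lie_mem_filtrationExt' (l := d + k + 1) (by omega) hP hv
    have h6 := sub_mem (sub_mem h1 h4) h5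
    rw [← sub_eq_iff_eq_add] at hwv
    rw [← hwv]
    convert h6 using 1
    rw [lie_sub, lie_sub, sub_lie]
    abel
  have hw0 : w = 0 := hinj w hwd
    (((hasDegree_tmul (1 : R) hp).lie hwd).eq_zero_of_mem (by omega) h3)
  rw [hwv, hw0, zero_add]
  exact hv

/-- A Borel automorphism that fixes the `fᵢ` to leading order is unipotent. -/
lemma map_sub_mem_of_map_f (hb : IsBorelAutomorphism Δ b) (C : ChevalleyGenerators Δ)
    (hf : ∀ i, b (1 ⊗ₜ C.f i) - 1 ⊗ₜ C.f i ∈ filtrationExt Δ R 0) {k : ℤ} {x : 𝔤}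
    (hx : x ∈ gradedPiece Δ k) : b (1 ⊗ₜ x) - 1 ⊗ₜ x ∈ filtrationExt Δ R (k + 1) := by
  have h0 : ∀ x ∈ gradedPiece Δ 0, b (1 ⊗ₜ x) - 1 ⊗ₜ x ∈ filtrationExt Δ R (0 + 1) := by
    intro x hx
    rw [gradedPiece_zero] at hx
    exact hb.map_cartan x hx
  have hF : C.principalF (1 : Δ.support → Rˣ) = 1 ⊗ₜ ∑ i, C.f i := by
    rw [TensorProduct.tmul_sum]
    rfl
  have hE : C.principalE (1 : Δ.support → Rˣ) =
      1 ⊗ₜ ∑ i, ChevalleyGenerators.coeff Δ i • C.e i := by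
    rw [TensorProduct.tmul_sum, ChevalleyGenerators.principalE]
    simp
  -- Start from `𝔥` and go up: `ad ∑ fᵢ` lowers degree `k + 1` to degree `k` injectively.
  have hup : ∀ k : ℤ, 0 ≤ k → ∀ x ∈ gradedPiece Δ k,
      b (1 ⊗ₜ x) - 1 ⊗ₜ x ∈ filtrationExt Δ R (k + 1) := by
    intro k hk
    induction k, hk using Int.leInduction with
    | base => exact h0
    | succ k hk ih =>
      intro x hx
      refine hb.map_sub_mem_step (d := -1) (p := ∑ i, C.f i)
        (sum_mem fun i _ => C.f_mem_gradedPiece i) ?_ (fun w hw h => ?_) ?_ hx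
      · rw [TensorProduct.tmul_sum, map_sum, ← Finset.sum_sub_distrib]
        exact sum_mem fun i _ => hf i
      · rw [← hF] at h
        exact C.eq_zero_of_lie_principalF 1 (by omega) hw h
      · rw [neg_add_cancel_comm_assoc]
        exact ih
  -- Going down uses `∑ cᵢ eᵢ` instead, whose triviality to leading order is the case of degree `1`
  -- just proved.
  have hdown : ∀ k : ℤ, k ≤ 0 → ∀ x ∈ gradedPiece Δ k,
      b (1 ⊗ₜ x) - 1 ⊗ₜ x ∈ filtrationExt Δ R (k + 1) := by
    intro k hk
    induction k, hk using Int.leInductionDown with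
    | base => exact h0
    | pred k hk ih =>
      intro x hx
      have hEm : ∑ i, ChevalleyGenerators.coeff Δ i • C.e i ∈ gradedPiece Δ 1 :=
        sum_mem fun i _ => Submodule.smul_mem _ _ (C.e_mem_gradedPiece i)
      refine hb.map_sub_mem_step (d := 1) hEm (hup 1 (by omega) _ hEm) (fun w hw h => ?_) ?_ hx
      · rw [← hE] at h
        exact C.eq_zero_of_lie_principalE 1 (by omega) hw h
      · rw [add_sub_cancel]
        exact ih
  rcases le_total 0 k with hk | hk
  · exact hup k hk x hx
  · exact hdown k hk x hx

/-- If `b` is unipotent and `b ρ^∨ - ρ^∨ ∈ 𝔤^m` then `b - 1` raises degrees by `m`. -/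
lemma map_sub_mem_of_map_gradingElement (hb : IsBorelAutomorphism Δ b)
    (hgr : ∀ {k : ℤ} {x : 𝔤}, x ∈ gradedPiece Δ k →
      b (1 ⊗ₜ x) - 1 ⊗ₜ x ∈ filtrationExt Δ R (k + 1)) {m : ℤ} (hm : 1 ≤ m)
    (hy : b (1 ⊗ₜ (gradingElement Δ : 𝔤)) - 1 ⊗ₜ (gradingElement Δ : 𝔤) ∈ filtrationExt Δ R m)
    {k : ℤ} {x : R ⊗[ℂ] 𝔤} (hx : x ∈ filtrationExt Δ R k) :
    b x - x ∈ filtrationExt Δ R (k + m) := by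
  have key : ∀ {r : ℤ} {x : 𝔤}, x ∈ gradedPiece Δ r →
      b (1 ⊗ₜ x) - 1 ⊗ₜ x ∈ filtrationExt Δ R (r + m) := by
    intro r x hx
    -- From `[bρ^∨, bx] = r bx` one gets `(ad ρ^∨ - r)(bx - x) = -[bρ^∨ - ρ^∨, bx] ∈ 𝔤^{r+m}`;
    -- unipotence puts `bx - x` in `𝔤^{r+1}`, past the bad degree `r`.
    refine mem_filtrationExt_of_lie_sub_mem (j := r) (by omega) (fun i hi _ => by omega) (hgr hx) ?_
    have hd := hasDegree_tmul (1 : R) hx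
    rw [HasDegree] at hd
    have h1 := congrArg b hd
    rw [hb.map_lie, map_smul] at h1
    have h2 := lie_mem_filtrationExt' (l := r + m) (by omega) hy
      (hb.map_mem (tmul_mem_filtrationExt (1 : R) hx))
    rw [sub_lie, h1] at h2
    have h3 := neg_mem h2
    convert h3 using 1
    rw [lie_sub, hd, smul_sub]
    abel
  refine map_baseChange_mem_of_one_tmul (b - LinearMap.id) (fun x hx => ?_) hx
  refine filtration_induction Δ (p := fun x => (b - LinearMap.id : Module.End R (R ⊗[ℂ] 𝔤)) (1 ⊗ₜ x) ∈
    (filtration Δ (k + m)).baseChange R) (by simp) (fun a c ha hc => ?_) (fun r hr x hx => ?_) hx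
  · rw [TensorProduct.tmul_add, map_add]
    exact add_mem ha hc
  · exact mem_filtrationExt_of_le (by omega) (key hx)

end IsBorelAutomorphism

lemma derExt_mem_filtrationExt (D : Derivation ℂ R R) {k : ℤ} {x : R ⊗[ℂ] 𝔤}
    (hx : x ∈ filtrationExt Δ R k) : derExt 𝔤 D x ∈ filtrationExt Δ R k :=
  map_baseChange_mem (derExt 𝔤 D) (fun r x hx => by
    rw [derExt, LinearMap.rTensor_tmul]
    exact Submodule.tmul_mem_baseChange_of_mem _ hx) hx

/-- A Borel gauge transformation that fixes an oper connection `D + A` is trivial. -/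
theorem IsBorelAutomorphism.eq_one {b : Module.End R (R ⊗[ℂ] 𝔤)} (hb : IsBorelAutomorphism Δ b)
    (C : ChevalleyGenerators Δ) (D : Derivation ℂ R R) (A : R ⊗[ℂ] 𝔤)
    (hA : A ∈ filtrationExt Δ R (-1)) (u : Δ.support → Rˣ)
    (hu : ∀ i, (rootProj H ⇑(-simpleRoot Δ i)).baseChange R A = (u i : R) ⊗ₜ C.f i)
    (hconn : ∀ x, derExt 𝔤 D (b x) + ⁅A, b x⁆ = b (derExt 𝔤 D x + ⁅A, x⁆)) : b = 1 := by
  have hA' : A - C.principalF u ∈ filtrationExt Δ R 0 := by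
    have := sub_sum_rootProj_baseChange_mem hA
    simp only [hu] at this
    exact this
  have hρ := tmul_mem_filtrationExt (1 : R) (mem_gradedPiece_of_gradingElement Δ)
  have hρ1 := hb.map_cartan _ (gradingElement Δ).2
  -- On constant vectors `D` vanishes, and `b[A, x] = [bA, bx]`.
  have hz : ∀ x : 𝔤, derExt 𝔤 D (b (1 ⊗ₜ x) - 1 ⊗ₜ x) = ⁅b A - A, b (1 ⊗ₜ x)⁆ := by
    intro x
    have := hconn (1 ⊗ₜ x)
    rw [derExt_one_tmul, zero_add, hb.map_lie] at this
    rw [map_sub, derExt_one_tmul, sub_zero, sub_lie, ← this, add_sub_cancel_right]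
  -- At `x = ρ^∨`, with `y = bρ^∨ - ρ^∨` and `z = bA - A`, this reads `[ρ^∨, z] = [z, y] - D y`. The
  -- summand with factor `0` is the eigenvalue `j = 0` of `mem_filtrationExt_of_lie_sub_mem`.
  have hρz : ∀ {m l : ℤ},
      b (1 ⊗ₜ (gradingElement Δ : 𝔤)) - 1 ⊗ₜ (gradingElement Δ : 𝔤) ∈ filtrationExt Δ R m →
      b A - A ∈ filtrationExt Δ R l → ∀ n, n ≤ m → n ≤ l + m →
      ⁅(1 : R) ⊗ₜ[ℂ] (gradingElement Δ : 𝔤), b A - A⁆ - ((0 : ℤ) : R) • (b A - A) ∈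
        filtrationExt Δ R n := by
    intro m l hy hzl n hn hn'
    have h1 := mem_filtrationExt_of_le hn (derExt_mem_filtrationExt D hy)
    rw [hz] at h1
    have h2 := lie_mem_filtrationExt' hn' hzl hy
    have h3 := sub_mem h2 h1
    convert h3 using 1
    rw [Int.cast_zero, zero_smul, sub_zero, ← lie_skew, lie_sub (b A - A), sub_sub_cancel_left]
  have hz0 : b A - A ∈ filtrationExt Δ R 0 := by
    have hz1 : b A - A ∈ filtrationExt Δ R (-1) := sub_mem (hb.map_mem hA) hA
    exact mem_filtrationExt_of_lie_sub_mem (j := 0) (by omega) (fun i _ _ => by omega) hz1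
      (hρz hρ1 hz1 0 (by omega) (by omega))
  have hw : b (C.principalF u) - C.principalF u =
      (b A - A) - (b (A - C.principalF u) - (A - C.principalF u)) := by
    rw [map_sub]
    abel
  have hf : ∀ i, b (1 ⊗ₜ C.f i) - 1 ⊗ₜ C.f i ∈ filtrationExt Δ R 0 := by
    have h1 : ∀ i, ∃ d : R, b (1 ⊗ₜ C.f i) - d ⊗ₜ C.f i ∈ filtrationExt Δ R 0 := by
      intro i
      obtain ⟨d, hd⟩ := C.exists_eq_smul i (baseChange_apply_mem
        (rootProj_mem ⇑(-simpleRoot Δ i)) (b (1 ⊗ₜ C.f i)))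
      refine ⟨d, ?_⟩
      rw [← hd]
      exact sub_rootProj_baseChange_mem i (hb.map_neg_simpleRoot i _ (C.f_mem i))
    choose d hd using h1
    have htm : ∀ (r s : R) (x : 𝔤), ((r * s) ⊗ₜ[ℂ] x : R ⊗[ℂ] 𝔤) = r • (s ⊗ₜ[ℂ] x) := by
      intro r s x
      rw [TensorProduct.smul_tmul', smul_eq_mul]
    -- Modulo `𝔟` the sum is `bF - F`, which is `z` up to an element of `𝔟`. Projecting to each
    -- `𝔤^{-αᵢ}` and cancelling the unit `uᵢ` gives `dᵢ = 1`.
    have h2 : ∑ i, ((u i : R) * (d i - 1)) ⊗ₜ[ℂ] C.f i ∈ filtrationExt Δ R 0 := by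
      have h3 : b (C.principalF u) - C.principalF u ∈ filtrationExt Δ R 0 := by
        rw [hw]
        exact sub_mem hz0 (sub_mem (hb.map_mem hA') hA')
      have h4 : ∑ i, (u i : R) • (b (1 ⊗ₜ C.f i) - d i ⊗ₜ C.f i) ∈ filtrationExt Δ R 0 :=
        sum_mem fun i _ => Submodule.smul_mem _ _ (hd i)
      have h5 := sub_mem h3 h4
      convert h5 using 1
      rw [ChevalleyGenerators.principalF, map_sum, ← Finset.sum_sub_distrib,
        ← Finset.sum_sub_distrib]
      refine Finset.sum_congr rfl fun i _ => ?_
      have h6 : ((u i : R) ⊗ₜ[ℂ] C.f i : R ⊗[ℂ] 𝔤) = (u i : R) • ((1 : R) ⊗ₜ[ℂ] C.f i) := by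
        rw [← htm, mul_one]
      rw [h6, map_smul, htm, TensorProduct.sub_tmul, smul_sub, smul_sub]
      abel
    intro i
    have h3 := rootProj_baseChange_eq_zero i h2
    rw [map_sum, Finset.sum_eq_single i] at h3
    · rw [LinearMap.baseChange_tmul, rootProj_apply_of_mem (C.f_mem i),
        ← mul_one ((u i : R) * (d i - 1)), htm] at h3
      have h4 := one_tmul_smul_eq_zero (C.f_ne_zero i) h3
      rw [Units.mul_right_eq_zero, sub_eq_zero] at h4
      have h5 := hd i
      rwa [h4] at h5
    · intro j _ hj
      rw [LinearMap.baseChange_tmul, C.rootProj_f_of_ne hj, TensorProduct.tmul_zero]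
    · simp
  have hgr : ∀ {k : ℤ} {x : 𝔤}, x ∈ gradedPiece Δ k →
      b (1 ⊗ₜ x) - 1 ⊗ₜ x ∈ filtrationExt Δ R (k + 1) := hb.map_sub_mem_of_map_f C hf
  have hz1 : b A - A ∈ filtrationExt Δ R 1 := by
    obtain ⟨z₀, hz₀, z', hz', hzz⟩ := exists_eq_add_of_mem_filtrationExt hz0
    have hcomb : ∃ r : Δ.support → R, z₀ = ∑ i, r i ⊗ₜ[ℂ] (coweight Δ i : 𝔤) := by
      refine baseChange_induction
        (p := fun z => ∃ r : Δ.support → R, z = ∑ i, r i ⊗ₜ[ℂ] (coweight Δ i : 𝔤))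
        ⟨0, by simp⟩ ?_ (fun s x hx => ?_) hz₀
      · rintro _ _ ⟨r, rfl⟩ ⟨s, rfl⟩
        exact ⟨r + s, by simp [TensorProduct.add_tmul, Finset.sum_add_distrib]⟩
      · rw [gradedPiece_zero] at hx
        refine ⟨fun i => simpleRoot Δ i ⟨x, hx⟩ • s, ?_⟩
        have h1 := congrArg (fun h : H => (h : 𝔤)) (eq_sum_coweight Δ ⟨x, hx⟩)
        simp only [AddSubmonoidClass.coe_finsetSum, SetLike.val_smul] at h1
        conv_lhs => rw [h1]
        rw [TensorProduct.tmul_sum]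
        exact Finset.sum_congr rfl fun i _ => by
          rw [TensorProduct.tmul_smul, TensorProduct.smul_tmul']
    obtain ⟨r, rfl⟩ := hcomb
    -- Modulo `𝔤^2` the gauge equation at `eᵢ` says `[z₀, eᵢ] = 0`, because `b eᵢ - eᵢ ∈ 𝔤^2`; and
    -- `[z₀, eᵢ] = rᵢ eᵢ` as the coweights are dual to the simple roots.
    have hr : ∀ i, r i = 0 := by
      intro i
      have he := tmul_mem_filtrationExt (1 : R) (C.e_mem_gradedPiece i)
      have h1 := hgr (C.e_mem_gradedPiece i)
      have h2 := derExt_mem_filtrationExt D h1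
      rw [hz] at h2
      have h3 := lie_mem_filtrationExt' (l := 1 + 1) (by omega) hz0 h1
      have h4 := lie_mem_filtrationExt' (l := 1 + 1) (by omega) hz' he
      have h5 := sub_mem (sub_mem h2 h3) h4
      rw [← lie_sub, sub_sub_cancel, ← sub_lie, hzz, add_sub_cancel_right] at h5
      have h6 := ((hasDegree_of_mem_baseChange hz₀).lie
        (hasDegree_tmul (1 : R) (C.e_mem_gradedPiece i))).eq_zero_of_mem (by omega) h5
      rw [sum_lie, Finset.sum_eq_single i] at h6
      · rw [ExtendScalars.bracket_tmul] at h6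
        have h7 : ⁅(coweight Δ i : 𝔤), C.e i⁆ = C.e i := by
          have := IsKilling.lie_eq_smul_of_mem_rootSpace (C.e_mem i) (coweight Δ i)
          rw [simpleRoot_coweight, if_pos rfl, one_smul] at this
          exact this
        rw [h7] at h6
        refine one_tmul_smul_eq_zero (C.e_ne_zero i) (r := r i) ?_
        rw [TensorProduct.smul_tmul', smul_eq_mul]
        exact h6
      · intro j _ hj
        have h7 : ⁅(coweight Δ j : 𝔤), C.e i⁆ = 0 := by
          have := IsKilling.lie_eq_smul_of_mem_rootSpace (C.e_mem i) (coweight Δ j)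
          rw [simpleRoot_coweight, if_neg hj.symm, zero_smul] at this
          exact this
        rw [ExtendScalars.bracket_tmul, h7, TensorProduct.tmul_zero]
      · simp
    rw [hzz]
    simpa [hr] using hz'
  have hy : ∀ m : ℤ, 1 ≤ m →
      b (1 ⊗ₜ (gradingElement Δ : 𝔤)) - 1 ⊗ₜ (gradingElement Δ : 𝔤) ∈ filtrationExt Δ R m := by
    intro m hm
    induction m, hm using Int.leInduction with
    | base => exact hρ1
    | succ m hm ih =>
      have hG := fun {k : ℤ} {x : R ⊗[ℂ] 𝔤} (hx : x ∈ filtrationExt Δ R k) =>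
        hb.map_sub_mem_of_map_gradingElement hgr hm ih hx
      -- Starting from `z ∈ 𝔤^1` is essential: `ad ρ^∨` is not invertible in degree `0`.
      have hzm : b A - A ∈ filtrationExt Δ R m :=
        mem_filtrationExt_of_lie_sub_mem (j := 0) hm (fun i _ _ => by omega) hz1
          (hρz ih hz1 m le_rfl (by omega))
      have hwm : b (C.principalF u) - C.principalF u ∈ filtrationExt Δ R m := by
        rw [hw]
        exact sub_mem hzm (mem_filtrationExt_of_le (by omega) (hG hA'))
      have hFd := C.hasDegree_principalF u
      have hFm : C.principalF u ∈ filtrationExt Δ R (-1) :=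
        sum_mem fun i _ => tmul_mem_filtrationExt _ (C.f_mem_gradedPiece i)
      obtain ⟨a, ha, y', hy', hay⟩ := exists_eq_add_of_mem_filtrationExt ih
      have had := hasDegree_of_mem_baseChange ha
      -- With `w = bF - F`, applying `b` to `[ρ^∨, F] = -F` gives `[y, F] = -([ρ^∨, w] + [y, w] + w)
      -- ∈ 𝔤^m`, whereas `[a, F]` has degree `m - 1`.
      have h1 : ⁅a, C.principalF u⁆ ∈ filtrationExt Δ R m := by
        have h2 := lie_mem_filtrationExt' (l := m) (by omega) hρ hwm
        have h3 := lie_mem_filtrationExt' (l := m) (by omega) ih hwm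
        have h4 := lie_mem_filtrationExt' (l := m) (by omega) hy' hFm
        have h5 := sub_mem (neg_mem (add_mem (add_mem h2 h3) hwm)) h4
        have h6 := congrArg b hFd
        rw [hb.map_lie, map_smul] at h6
        rw [HasDegree] at hFd
        rw [← sub_eq_iff_eq_add] at hay
        rw [← hay]
        convert h5 using 1
        simp only [sub_lie, lie_sub, h6, hFd, Int.cast_neg, Int.cast_one, neg_smul, one_smul]
        abel
      have h7 : ⁅C.principalF u, a⁆ = 0 := by
        rw [← lie_skew, neg_eq_zero]
        exact (had.lie hFd).eq_zero_of_mem (by omega) h1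
      rw [hay, C.eq_zero_of_lie_principalF u (by omega) had h7, zero_add]
      exact hy'
  refine LinearMap.ext fun x => sub_eq_zero.mp ?_
  obtain ⟨l, hl⟩ := exists_filtrationExt_eq_top Δ R
  -- From `𝔤^l`, which is everything, `b - 1` lands in `𝔤^k` when `m = k - l`; the bound `k ≥ l + 1`
  -- keeps `m ≥ 1`.
  refine eq_zero_of_forall_mem_filtrationExt (Δ := Δ) (l := l + 1) fun k hk => ?_
  have := hb.map_sub_mem_of_map_gradingElement hgr (m := k - l) (by omega) (hy _ (by omega)) (hl x)
  rwa [add_sub_cancel] at this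

end Gauge

/-! ### Rigidity of opers -/

section Rigidity

open LieAlgebra

universe w u

variable {X : TopCat.{0}} {O : TopCat.Presheaf (CommAlgCat.{0} ℂ) X}

lemma resO_self {U : Opens X} (f : O.obj (op U)) : resO O (le_refl U) f = f := by
  have h : O.map (homOfLE (le_refl U)).op = 𝟙 _ := O.map_id (op U)
  rw [resO, h]
  rfl

lemma extMap_resO_self {𝔤 : Type u} [AddCommGroup 𝔤] [Module ℂ 𝔤] {U : Opens X}
    (y : O.obj (op U) ⊗[ℂ] 𝔤) :
    extMap 𝔤 (resO O (le_refl U)) y = y := by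
  induction y with
  | zero => simp
  | tmul a x => rw [extMap_tmul, resO_self]
  | add y z hy hz => rw [map_add, hy, hz]

lemma extMap_resO_resO {𝔤 : Type u} [AddCommGroup 𝔤] [Module ℂ 𝔤] {U V W : Opens X}
    (hV : V ≤ U) (hW : W ≤ V)
    (y : O.obj (op U) ⊗[ℂ] 𝔤) :
    extMap 𝔤 (resO O hW) (extMap 𝔤 (resO O hV) y) = extMap 𝔤 (resO O (hW.trans hV)) y := by
  induction y with
  | zero => simp
  | tmul a x => simp only [extMap_tmul, VectorField.resO_resO]
  | add y z hy hz => simp only [map_add, hy, hz]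

variable {𝔤 : Type u} [LieRing 𝔤] [LieAlgebra ℂ 𝔤] [FiniteDimensional ℂ 𝔤]

namespace PrincipalBundle

variable {S T : Subgroup (LinearMap.GeneralLinearGroup ℂ 𝔤)} (F : PrincipalBundle.{w} O S)

lemma div_self {U : Opens X} (s : F.sec U) : F.div s s = 1 :=
  (F.eq_div (F.act_one s)).symm

lemma div_act {U : Opens X} (s t : F.sec U) (b : points S (O.obj (op U))) :
    F.div s (F.act t b) = F.div s t * b := by
  refine (F.eq_div ?_).symm
  rw [F.act_mul, F.act_div]

lemma div_res {U V : Opens X} (h : V ≤ U) (s t : F.sec U) :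
    F.div (F.res h s) (F.res h t) = pointsExt S (resO O h) (F.div s t) := by
  refine (F.eq_div ?_).symm
  rw [← F.res_act, F.act_div]

lemma toInduced_act (hST : S ≤ T) {U : Opens X} (s : F.sec U) (b : points S (O.obj (op U))) :
    F.toInduced hST (F.act s b) =
      (F.induced hST).act (F.toInduced hST s) (Subgroup.inclusion (points_mono hST _) b) := by
  refine GSpace.InducedSec.ext ?_
  funext V hV t
  change Subgroup.inclusion (points_mono hST _) (F.div t (F.res hV (F.act s b))) =
    Subgroup.inclusion (points_mono hST _) (F.div t (F.res hV s)) *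
      pointsExt T (resO O hV) (Subgroup.inclusion (points_mono hST _) b)
  rw [F.res_act, div_act, map_mul]
  rfl

lemma Iso.mapInduced_toInduced {F F' : PrincipalBundle.{w} O S} (f : Iso F F') (hST : S ≤ T)
    {U : Opens X} (s : F.sec U) :
    f.mapInduced hST (F.toInduced hST s) = F'.toInduced hST (f.toEquiv U s) := by
  refine GSpace.InducedSec.ext ?_
  funext V hV t
  change Subgroup.inclusion (points_mono hST _) (F.div ((f.toEquiv V).symm t) (F.res hV s)) =
    Subgroup.inclusion (points_mono hST _) (F'.div t (F'.res hV (f.toEquiv U s)))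
  congr 1
  refine F'.eq_div ?_
  rw [← f.map_res, ← F.act_div ((f.toEquiv V).symm t) (F.res hV s), f.map_act,
    Equiv.apply_symm_apply, F.act_div]

end PrincipalBundle

variable [LieAlgebra.IsSemisimple ℂ 𝔤] {H : LieSubalgebra ℂ 𝔤} [H.IsCartanSubalgebra]
  {Δ : (LieAlgebra.IsKilling.rootSystem H).Base}

/-- The group preserves `𝔟`, so projecting away the `𝔟`-part beforehand changes nothing. This makes
act-then-project an action on `𝔤^{-α} ≅ (𝔤^{-α} + 𝔟) / 𝔟`. -/
lemma rootProj_points {R : Type*} [CommRing R] [Algebra ℂ R]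
    {φ : LinearMap.GeneralLinearGroup R (R ⊗[ℂ] 𝔤)}
    (hφ : φ ∈ points (borelSubgroup Δ) R) (i : Δ.support) {x : R ⊗[ℂ] 𝔤}
    (hx : x ∈ ((rootSpace H ⇑(-simpleRoot Δ i)).toSubmodule ⊔ filtration Δ 0).baseChange R) :
    (rootProj H ⇑(-simpleRoot Δ i)).baseChange R (φ.1 x) =
      (rootProj H ⇑(-simpleRoot Δ i)).baseChange R
        (φ.1 ((rootProj H ⇑(-simpleRoot Δ i)).baseChange R x)) := by
  rw [← sub_eq_zero, ← map_sub, ← map_sub]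
  exact rootProj_baseChange_eq_zero i ((isBorelAutomorphism_of_mem_points Δ hφ).map_mem
    (sub_rootProj_baseChange_mem i hx))

lemma points_map_mem_sup {R : Type*} [CommRing R] [Algebra ℂ R]
    {φ : LinearMap.GeneralLinearGroup R (R ⊗[ℂ] 𝔤)}
    (hφ : φ ∈ points (borelSubgroup Δ) R) (i : Δ.support) {x : R ⊗[ℂ] 𝔤}
    (hx : x ∈ (rootSpace H ⇑(-simpleRoot Δ i)).toSubmodule.baseChange R) :
    φ.1 x ∈ ((rootSpace H ⇑(-simpleRoot Δ i)).toSubmodule ⊔ filtration Δ 0).baseChange R :=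
  map_baseChange_mem_of_one_tmul φ.1
    (fun x hx => (isBorelAutomorphism_of_mem_points Δ hφ).map_neg_simpleRoot i x hx) hx

/-- The section of `𝔤^{-α}_F` whose value at the section `s` of `F` is `x`. -/
def twistSection (F : PrincipalBundle.{w} O (borelSubgroup Δ)) (i : Δ.support) {U : Opens X}
    (s : F.sec U) (x : O.obj (op U) ⊗[ℂ] 𝔤) :
    ∀ V : Opens X, V ≤ U → F.sec V → O.obj (op V) ⊗[ℂ] 𝔤 :=
  fun V hV t => (rootProj H ⇑(-simpleRoot Δ i)).baseChange (O.obj (op V))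
    ((F.div (F.res hV s) t)⁻¹.1.1 (extMap 𝔤 (resO O hV) x))

lemma twistSection_mem_rootTwist (F : PrincipalBundle.{w} O (borelSubgroup Δ)) (i : Δ.support)
    {U : Opens X} (s : F.sec U) {x : O.obj (op U) ⊗[ℂ] 𝔤}
    (hx : x ∈ (rootSpace H ⇑(-simpleRoot Δ i)).toSubmodule.baseChange (O.obj (op U))) :
    twistSection F i s x ∈ rootTwist F i U := by
  refine ⟨fun V hV t => baseChange_apply_mem (rootProj_mem _) _, fun V W hV hW t => ?_,
    fun V hV t b => ?_⟩
  · simp only [twistSection]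
    rw [extMap_baseChange, ← F.res_res hV hW, F.div_res, ← map_inv, ← extMap_resO_resO hV hW]
    congr 1
    exact endExt_extMap _ _ _
  · simp only [twistSection]
    have h : ((F.div (F.res hV s) (F.act t b))⁻¹.1.1 : Module.End _ _) =
        b⁻¹.1.1 * (F.div (F.res hV s) t)⁻¹.1.1 := by
      rw [F.div_act, mul_inv_rev]
      rfl
    rw [h, Module.End.mul_apply]
    exact rootProj_points b⁻¹.2 i
      (points_map_mem_sup (F.div (F.res hV s) t)⁻¹.2 i (extMap_mem_baseChange _ hx))

lemma twistSection_self (F : PrincipalBundle.{w} O (borelSubgroup Δ)) (i : Δ.support)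
    {U : Opens X} (s : F.sec U) {x : O.obj (op U) ⊗[ℂ] 𝔤}
    (hx : x ∈ (rootSpace H ⇑(-simpleRoot Δ i)).toSubmodule.baseChange (O.obj (op U))) :
    twistSection F i s x U le_rfl s = x := by
  simp only [twistSection]
  rw [F.res_self, F.div_self, extMap_resO_self, inv_one]
  change (rootProj H ⇑(-simpleRoot Δ i)).baseChange (O.obj (op U)) x = x
  refine baseChange_induction
    (p := fun x => (rootProj H ⇑(-simpleRoot Δ i)).baseChange (O.obj (op U)) x = x)
    (map_zero _) (fun a b ha hb => by rw [map_add, ha, hb]) (fun r x hx => ?_) hx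
  rw [LinearMap.baseChange_tmul, rootProj_apply_of_mem hx]

/-- Every section of `F` over a smaller open set is a translate of the restriction of `s`, so
equivariance determines all values. -/
lemma rootTwist_ext {F : PrincipalBundle.{w} O (borelSubgroup Δ)} {i : Δ.support} {U : Opens X}
    (s : F.sec U) {v v' : ∀ V : Opens X, V ≤ U → F.sec V → O.obj (op V) ⊗[ℂ] 𝔤}
    (hv : v ∈ rootTwist F i U) (hv' : v' ∈ rootTwist F i U)
    (h : v U le_rfl s = v' U le_rfl s) : v = v' := by
  funext V hV t
  rw [← F.act_div (F.res hV s) t, hv.2.2, hv'.2.2, hv.2.1 U V le_rfl hV, hv'.2.1 U V le_rfl hV, h]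

namespace Oper

variable (E : Oper.{w} O Δ)

lemma rootComponent_smul (i : Δ.support) {U : Opens X} (s : E.bundle.sec U) (r : O.obj (op U))
    (θ : VectorField O U) :
    rootComponent E.bundle i (E.conn.nabla (r • θ)) U le_rfl s =
      r • rootComponent E.bundle i (E.conn.nabla θ) U le_rfl s := by
  simp only [rootComponent]
  rw [E.conn.nabla_smul, resO_self, map_smul]

/-- Over an open set on which the bundle has a section, some vector field has a covariant
derivative all of whose components in the `𝔤^{-α}_F` are generators. -/
lemma exists_vectorField_rootComponent_eq (C : ChevalleyGenerators Δ) [Nonempty Δ.support]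
    {U : Opens X} (s : E.bundle.sec U) :
    ∃ (θ : VectorField O U) (u : Δ.support → (O.obj (op U))ˣ), ∀ i,
      rootComponent E.bundle i (E.conn.nabla θ) U le_rfl s = (u i : O.obj (op U)) ⊗ₜ C.f i := by
  have hmem : ∀ i θ, rootComponent E.bundle i (E.conn.nabla θ) ∈ rootTwist E.bundle i U :=
    fun i θ => (E.bijective i U).mapsTo (Set.mem_univ θ)
  have hcoef : ∀ i θ, ∃ r : O.obj (op U),
      rootComponent E.bundle i (E.conn.nabla θ) U le_rfl s = r ⊗ₜ C.f i :=
    fun i θ => C.exists_eq_smul i ((hmem i θ).1 U le_rfl s)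
  have hgen : ∀ i, ∃ θ : VectorField O U,
      rootComponent E.bundle i (E.conn.nabla θ) U le_rfl s = 1 ⊗ₜ C.f i := by
    intro i
    have hx : (1 : O.obj (op U)) ⊗ₜ[ℂ] C.f i ∈
        (rootSpace H ⇑(-simpleRoot Δ i)).toSubmodule.baseChange (O.obj (op U)) :=
      Submodule.tmul_mem_baseChange_of_mem _ (C.f_mem i)
    obtain ⟨θ, -, hθ⟩ := (E.bijective i U).surjOn (twistSection_mem_rootTwist E.bundle i s hx)
    refine ⟨θ, ?_⟩
    have := congrFun (congrFun (congrFun hθ U) le_rfl) s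
    rwa [twistSection_self E.bundle i s hx] at this
  choose η hη using hgen
  obtain ⟨i₀⟩ := ‹Nonempty Δ.support›
  choose r hr using fun i => hcoef i (η i₀)
  choose q hq using fun i => hcoef i₀ (η i)
  -- Bijectivity for the single root `i₀` makes `η i₀` a generator of the vector fields on `U`.
  have hη' : ∀ i, η i = q i • η i₀ := by
    intro i
    refine (E.bijective i₀ U).injOn (Set.mem_univ _) (Set.mem_univ _) ?_
    refine rootTwist_ext s (hmem _ _) (hmem _ _) ?_
    rw [rootComponent_smul, hη, hq, TensorProduct.smul_tmul', smul_eq_mul, mul_one]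
  -- Reading the `i`-th component of `η i = q i • η i₀` shows that the coefficients of `η i₀` are
  -- invertible.
  have hqr : ∀ i, q i * r i = 1 := by
    intro i
    have h1 := hη i
    rw [hη' i, rootComponent_smul, hr, TensorProduct.smul_tmul', smul_eq_mul] at h1
    refine sub_eq_zero.mp (one_tmul_smul_eq_zero (C.f_ne_zero i) ?_)
    rw [TensorProduct.smul_tmul', smul_eq_mul, mul_one, TensorProduct.sub_tmul, h1, sub_self]
  exact ⟨η i₀, fun i => Units.mk (r i) (q i) (by rw [mul_comm, hqr]) (hqr i), hr⟩

variable {E}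

/-- Every automorphism of an oper fixes every local section of the `B`-bundle. -/
lemma Iso.toEquiv_apply_eq (φ : Iso E E) {U : Opens X} (s : E.bundle.sec U) :
    φ.toEquiv U s = s := by
  obtain ⟨C⟩ := nonempty_chevalleyGenerators Δ
  set b := E.bundle.div s (φ.toEquiv U s) with hbdef
  have hact : E.bundle.act s b = φ.toEquiv U s := E.bundle.act_div _ _
  have hb := isBorelAutomorphism_of_mem_points Δ b.2
  have hgauge : ∀ (θ : VectorField O U) (y : O.obj (op U) ⊗[ℂ] 𝔤),
      derExt 𝔤 (θ.der U le_rfl) (b.1.1 y) +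
        ⁅(E.conn.nabla θ).form U le_rfl (E.bundle.toInduced (borelSubgroup_le Δ) s), b.1.1 y⁆ =
      b.1.1 (derExt 𝔤 (θ.der U le_rfl) y +
        ⁅(E.conn.nabla θ).form U le_rfl (E.bundle.toInduced (borelSubgroup_le Δ) s), y⁆) := by
    intro θ y
    -- The connection form at `s · b` equals the one at `s`; inserting this in the gauge rule and
    -- multiplying by `b` gives the commutation with `D + ad A`.
    have h1 := φ.map_conn θ U le_rfl (E.bundle.toInduced (borelSubgroup_le Δ) s)
    rw [PrincipalBundle.Iso.mapInduced_toInduced, ← hact, PrincipalBundle.toInduced_act] at h1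
    have h2 := (E.conn.nabla θ).gauge U le_rfl (E.bundle.toInduced (borelSubgroup_le Δ) s)
      (Subgroup.inclusion (points_mono (borelSubgroup_le Δ) _) b) y
    rw [h1, E.conn.anchor_nabla] at h2
    rw [h2]
    have h3 : ∀ v, b.1.1 (b⁻¹.1.1 v) = v := fun v => by
      have : b.1.1 * b⁻¹.1.1 = 1 := b.1.mul_inv
      rw [← Module.End.mul_apply, this, Module.End.one_apply]
    exact (h3 _).symm
  have hb1 : b.1.1 = 1 := by
    -- Without simple roots there is no component from which to choose `θ`, but the conditions on
    -- the `uᵢ` are then empty and `D = 0`, `A = 0` serve.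
    rcases isEmpty_or_nonempty Δ.support with he | hne
    · exact hb.eq_one C 0 0 (zero_mem _) 1 (fun i => he.elim i) (fun x => by simp [derExt])
    · obtain ⟨θ, u, hu⟩ := E.exists_vectorField_rootComponent_eq C s
      exact hb.eq_one C _ _ (E.nabla_mem θ U le_rfl s) u hu (hgauge θ)
  have : b = 1 := Subtype.ext (Units.ext hb1)
  rw [← hact, this, E.bundle.act_one]

/-- Opers have no nontrivial automorphisms. -/
theorem Iso.eq_refl (φ : Iso E E) : φ = Iso.refl E := by
  refine Iso.ext ?_
  funext U
  exact Equiv.ext fun s => φ.toEquiv_apply_eq s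

end Oper

end Rigidity

end

end Opers

/-- A `𝔤`-oper on a smooth algebraic curve `Y` over `ℂ` has no nontrivial automorphisms. -/
theorem proposition1p3 {𝔤 : Type*} [LieRing 𝔤] [LieAlgebra ℂ 𝔤] [FiniteDimensional ℂ 𝔤]
    [LieAlgebra.IsSemisimple ℂ 𝔤] (H : LieSubalgebra ℂ 𝔤) [H.IsCartanSubalgebra]
    (Δ : (LieAlgebra.IsKilling.rootSystem H).Base)
    (Y : Scheme.{0}) (π : Y ⟶ Spec (CommRingCat.of ℂ)) [SmoothOfRelativeDimension 1 π]
    (E : Opers.Oper (Opers.structureSheaf π) Δ) (φ : Opers.Oper.Iso E E) :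
    φ = Opers.Oper.Iso.refl E :=
  φ.eq_refl
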